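/- Let $R$ be a unital ring. Let $G$ be a group, $X$ and $\overline X$ topological spaces with a $G$-action, and $p:\overline X\to X$ a $G$-map; $G$ acts trivially on $[1,\infty)$ and on $[1,\infty]$. **The category $\mathcal O^G(\overline X)$.** An object is a family $A=(A_a)_{a\in\overline X\times[1,\infty)}$ of finitely generated free $R$-modules with $A_{ga}=A_a$ for all $g\in G$, whose support $\operatorname{supp}(A)=\{a: A_a\neq 0\}$ is locally finite (every point of $\overline X\times[1,\infty)$ has an open neighbourhood meeting it in a finite set) and is contained in $GK\times[1,\infty)$ for some compact $K\subseteq\overline X$. A morphism $\varphi:A\to B$ is a family of $R$-linear maps $\varphi_a^b:A_a\to B_b$ such that for every $a$ only finitely many $\varphi_a^b$, and for every $b$ only finitely many $\varphi_a^b$, are non-zero, $\varphi_{ga}^{gb}=\varphi_a^b$ for all $g\in G$, and there is $E\in\mathcal E^X_{Gcc}$ with $((p(x),t),(p(y),s))\in E$ whenever $\varphi_{(x,t)}^{(y,s)}\ne 0$. Composition is matrix multiplication. Here $\mathcal E^X_{Gcc}$ is the collection of all $E\subseteq (X\times[1,\infty))^2$ such that 1. for every $x\in X$ and every $G_x$-invariant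 open neighbourhood $U$ of $(x,\infty)$ in $X\times[1,\infty]$ there is a $G_x$-invariant open neighbourhood $V\subseteq U$ of $(x,\infty)$ with $((X\times[1,\infty]\setminus U)\times V)\cap E=\emptyset$; 2. there is $\delta<\infty$ with $|t-s|\le\delta$ for all $((x,t),(y,s))\in E$; 3. $E$ is symmetric and invariant under the diagonal action of $G$. **The two examples.** $\widetilde{\mathcal O}^{\langle t\rangle}(\mathbb R)$ is this category for $G=\langle t\rangle$ infinite cyclic and $p=\mathrm{id}_{\mathbb R}$, where $t$ acts on $\mathbb R$ by $x\mapsto x+1$. $\mathcal O^{D_\infty}(\overline{\mathbb R})$ is this category for $G=D_\infty=\langle r,s\mid s^2=1,\ rs=sr^{-1}\rangle$ and the projection $p:\overline{\mathbb R}=\mathbb Z/2\times\mathbb R\to\mathbb R$, where $\mathbb Z/2$ is discrete, $r$ acts on $\mathbb R$ by $x\mapsto x+1$ and trivially on $\mathbb Z/2$, $s$ acts on $\mathbb R$ by $x\mapsto -x$ and exchanges the two elements of $\mathbb Z/2$, and $D_\infty$ acts diagonally on $\overline{\mathbb R}$. **Size.** An automorphism $\alpha$ in one of these two categories is an *$\varepsilon$-automorphism*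 if $|p(x)-p(y)|<\varepsilon$ whenever $\alpha_{(x,t)}^{(y,s)}\neq0$ or $(\alpha^{-1})_{(x,t)}^{(y,s)}\ne0$. **Restriction.** A morphism $\varphi:A\to B$ in one of these two categories *restricts to* an open interval $I\subset\mathbb R$ of length $1$ if $p(x)\notin\partial I$ for all $(x,t)$ in $\operatorname{supp}(A)\cup\operatorname{supp}(B)$, and $\varphi_{(x,t)}^{(y,s)}=0=\varphi_{(y,s)}^{(x,t)}$ whenever $p(x)\in I$ and $p(y)\notin I$. **$K_1$.** For an additive category $\mathcal A$, $K_1(\mathcal A)$ is the abelian group generated by the classes $[\alpha]$ of the automorphisms $\alpha$ of objects of $\mathcal A$, with the relations $[\alpha\circ\beta]=[\alpha]+[\beta]$ for automorphisms of the same object, and $[\alpha_2]=[\alpha_1]+[\alpha_3]$ for every automorphism $(\alpha_1,\alpha_2,\alpha_3)$ of a split short exact sequence. **Theorem.** Let $\alpha:A\to A$ be a $\frac1{30}$-automorphism in $\widetilde{\mathcal O}^{\langle t\rangle}(\mathbb R)$. Then there is an automorphism $\beta:B\to B$ in $\widetilde{\mathcal O}^{\langle t\rangle}(\mathbb R)$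 with $[\alpha]=[\beta]$ in $K_1(\widetilde{\mathcal O}^{\langle t\rangle}(\mathbb R))$ such that $\beta$ restricts to $\left(\frac12,\frac32\right)$. The same is true with $\mathcal O^{D_\infty}(\overline{\mathbb R})$ instead of $\widetilde{\mathcal O}^{\langle t\rangle}(\mathbb R)$. -/

import Mathlib

open CategoryTheory

universe u

namespace ControlledAlgebra

/-! ### `K₁` of an additive category -/

section K1

variable (C : Type*) [Category C] [Preadditive C]

/-- The defining relations of `K₁`: an automorphism `f` of an object `X` is a generator `[X, f]`, and
* `[X, f ∘ g] = [X, f] + [X, g]`;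
* `[X₂, f₂] = [X₁, f₁] + [X₃, f₃]` whenever `f₁, f₂, f₃` form an automorphism of a split short
  exact sequence `0 → X₁ → X₂ → X₃ → 0`. -/
def K1Relations : Set (FreeAbelianGroup (Σ X : C, Aut X)) :=
  {z | ∃ (X : C) (f g : Aut X),
      z = FreeAbelianGroup.of ⟨X, f * g⟩
        - (FreeAbelianGroup.of ⟨X, f⟩ + FreeAbelianGroup.of ⟨X, g⟩)} ∪
  {z | ∃ (S : ShortComplex C) (f₁ : Aut S.X₁) (f₂ : Aut S.X₂) (f₃ : Aut S.X₃),
      Nonempty S.Splitting ∧ f₁.hom ≫ S.f = S.f ≫ f₂.hom ∧ f₂.hom ≫ S.g = S.g ≫ f₃.hom ∧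
      z = FreeAbelianGroup.of ⟨S.X₂, f₂⟩
        - (FreeAbelianGroup.of ⟨S.X₁, f₁⟩ + FreeAbelianGroup.of ⟨S.X₃, f₃⟩)}

/-- `K₁` of an additive category (with its split exact structure). -/
abbrev K1 : Type _ :=
  FreeAbelianGroup (Σ X : C, Aut X) ⧸ AddSubgroup.closure (K1Relations C)

variable {C}

/-- The class in `K₁` of an automorphism. -/
def K1.cls {X : C} (f : Aut X) : K1 C :=
  QuotientAddGroup.mk (FreeAbelianGroup.of ⟨X, f⟩)

end K1

/-! ### Control conditions -/

/-- The half line `[1, ∞)`. -/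
abbrev Ray : Type := Set.Ici (1 : ℝ)

/-- The compactified half line `[1, ∞]`. -/
abbrev RayInf : Type := Set.Ici (1 : EReal)

/-- The inclusion `[1, ∞) ⊂ [1, ∞]`. -/
def Ray.toInf (t : Ray) : RayInf := ⟨((t : ℝ) : EReal), by
  have h : (1 : ℝ) ≤ t := t.2
  have h' : (1 : EReal) ≤ ((t : ℝ) : EReal) := by exact_mod_cast h
  exact h'⟩

/-- The point `∞` of `[1, ∞]`. -/
noncomputable def infPt : RayInf := ⟨⊤, Set.mem_Ici.2 le_top⟩

/-- The action of `g` on `X × T`, where `G` acts trivially on `T`. -/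
def actFst {G X T : Type*} [SMul G X] (g : G) (a : X × T) : X × T := (g • a.1, a.2)

section Control

variable (G : Type*) [Group G] {X : Type*} [TopologicalSpace X] [MulAction G X]

/-- `U` is an open neighbourhood of `(x, ∞)` in `X × [1, ∞]`, invariant under the stabilizer
`G_x`. -/
def IsInvNhd (x : X) (U : Set (X × RayInf)) : Prop :=
  IsOpen U ∧ (x, infPt) ∈ U ∧ ∀ g ∈ MulAction.stabilizer G x, ∀ a ∈ U, actFst g a ∈ U

/-- The equivariant continuous control condition: `E ⊆ (X × [1, ∞))²` is a member of the
collection `ℰ_{Gcc}^X`. -/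
structure IsControlSet (E : Set ((X × Ray) × (X × Ray))) : Prop where
  continuous_control : ∀ (x : X) (U : Set (X × RayInf)), IsInvNhd G x U →
    ∃ V, V ⊆ U ∧ IsInvNhd G x V ∧
      ∀ a b : X × Ray, (a.1, a.2.toInf) ∉ U → (b.1, b.2.toInf) ∈ V → (a, b) ∉ E
  bounded : ∃ δ : ℝ, ∀ a b, (a, b) ∈ E → |(a.2 : ℝ) - b.2| ≤ δ
  symm : ∀ a b, (a, b) ∈ E → (b, a) ∈ E
  invariant : ∀ (g : G) (a b), (a, b) ∈ E → (actFst g a, actFst g b) ∈ E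

variable {G}

theorem IsInvNhd.inter {x : X} {U V : Set (X × RayInf)} (hU : IsInvNhd G x U)
    (hV : IsInvNhd G x V) : IsInvNhd G x (U ∩ V) :=
  ⟨hU.1.inter hV.1, ⟨hU.2.1, hV.2.1⟩, fun g hg a ha =>
    ⟨hU.2.2 g hg a ha.1, hV.2.2 g hg a ha.2⟩⟩

theorem IsControlSet.union {E F : Set ((X × Ray) × (X × Ray))} (hE : IsControlSet G E)
    (hF : IsControlSet G F) : IsControlSet G (E ∪ F) where
  continuous_control x U hU := by
    obtain ⟨V, hVU, hV, h⟩ := hE.continuous_control x U hU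
    obtain ⟨W, hWU, hW, h'⟩ := hF.continuous_control x U hU
    refine ⟨V ∩ W, fun a ha => hVU ha.1, hV.inter hW, fun a b ha hb hab => ?_⟩
    rcases hab with hab | hab
    · exact h a b ha hb.1 hab
    · exact h' a b ha hb.2 hab
  bounded := by
    obtain ⟨δ, h⟩ := hE.bounded
    obtain ⟨δ', h'⟩ := hF.bounded
    refine ⟨max δ δ', fun a b hab => ?_⟩
    rcases hab with hab | hab
    · exact (h a b hab).trans (le_max_left _ _)
    · exact (h' a b hab).trans (le_max_right _ _)
  symm a b hab := hab.imp (hE.symm a b) (hF.symm a b)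
  invariant g a b hab := hab.imp (hE.invariant g a b) (hF.invariant g a b)

theorem IsControlSet.diag : IsControlSet G {e : (X × Ray) × (X × Ray) | e.1 = e.2} where
  continuous_control x U hU := ⟨U, subset_rfl, hU, fun a b ha hb hab => by
    have h : a = b := hab
    exact ha (h ▸ hb)⟩
  bounded := ⟨0, fun a b hab => by
    have h : a = b := hab
    simp [h]⟩
  symm _ _ hab := Eq.symm hab
  invariant g a b hab := congrArg (actFst g) (show a = b from hab)

theorem IsControlSet.comp {E F : Set ((X × Ray) × (X × Ray))} (hE : IsControlSet G E)
    (hF : IsControlSet G F) :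
    IsControlSet G {e | (∃ b, (e.1, b) ∈ E ∧ (b, e.2) ∈ F) ∨ ∃ b, (e.1, b) ∈ F ∧ (b, e.2) ∈ E} where
  continuous_control x U hU := by
    obtain ⟨V, hVU, hV, h⟩ := hE.continuous_control x U hU
    obtain ⟨V', -, hV', h'⟩ := hF.continuous_control x V hV
    obtain ⟨W, hWU, hW, k⟩ := hF.continuous_control x U hU
    obtain ⟨W', -, hW', k'⟩ := hE.continuous_control x W hW
    refine ⟨U ∩ (V' ∩ W'), fun a ha => ha.1, hU.inter (hV'.inter hW'), fun a c ha hc hac => ?_⟩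
    rcases hac with ⟨b, hab, hbc⟩ | ⟨b, hab, hbc⟩
    · by_cases hb : (b.1, b.2.toInf) ∈ V
      · exact h a b ha hb hab
      · exact h' b c hb hc.2.1 hbc
    · by_cases hb : (b.1, b.2.toInf) ∈ W
      · exact k a b ha hb hab
      · exact k' b c hb hc.2.2 hbc
  bounded := by
    obtain ⟨δ, h⟩ := hE.bounded
    obtain ⟨δ', h'⟩ := hF.bounded
    refine ⟨δ + δ', fun a c hac => ?_⟩
    rcases hac with ⟨b, hab, hbc⟩ | ⟨b, hab, hbc⟩
    · exact (abs_sub_le _ (b.2 : ℝ) _).trans (add_le_add (h a b hab) (h' b c hbc))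
    · rw [add_comm δ]
      exact (abs_sub_le _ (b.2 : ℝ) _).trans (add_le_add (h' a b hab) (h b c hbc))
  symm a c hac := by
    rcases hac with ⟨b, hab, hbc⟩ | ⟨b, hab, hbc⟩
    · exact Or.inr ⟨b, hF.symm _ _ hbc, hE.symm _ _ hab⟩
    · exact Or.inl ⟨b, hE.symm _ _ hbc, hF.symm _ _ hab⟩
  invariant g a c hac := by
    rcases hac with ⟨b, hab, hbc⟩ | ⟨b, hab, hbc⟩
    · exact Or.inl ⟨actFst g b, hE.invariant g _ _ hab, hF.invariant g _ _ hbc⟩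
    · exact Or.inr ⟨actFst g b, hF.invariant g _ _ hab, hE.invariant g _ _ hbc⟩

end Control

/-! ### The obstruction category -/

section Category

variable (R : Type u) [Ring R] (G : Type*) [Group G] {X Y : Type*}
  [TopologicalSpace X] [MulAction G X] [TopologicalSpace Y] [MulAction G Y]

/-- Objects of the obstruction category `𝒪^G(Y)` of a `G`-space `Y` with a map `p : Y → X` to a
`G`-space `X`: `G`-invariant families of finitely generated free `R`-modules indexed by
`Y × [1, ∞)`, with locally finite support, contained in `GK × [1, ∞)` for a compact `K ⊆ Y`.
(The map `p` enters in the control condition on the morphisms.) -/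
@[nolint unusedArguments]
structure Obstr (p : Y → X) where
  /-- the module at a point -/
  mod : Y × Ray → ModuleCat.{u} R
  free : ∀ a, Module.Free R (mod a)
  finite : ∀ a, Module.Finite R (mod a)
  invariant : ∀ (g : G) (a), mod (actFst g a) = mod a
  locallyFinite : ∀ a, ∃ U : Set (Y × Ray), IsOpen U ∧ a ∈ U ∧
    (U ∩ {b | Nontrivial (mod b)}).Finite
  cocompact : ∃ K : Set Y, IsCompact K ∧
    ∀ a, Nontrivial (mod a) → ∃ g : G, ∃ k ∈ K, a.1 = g • k

variable {R G} {p : Y → X}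

/-- The support of an object. -/
def Obstr.supp (A : Obstr R G p) : Set (Y × Ray) := {a | Nontrivial (A.mod a)}

/-- Morphisms of the obstruction category: row- and column-finite `G`-invariant matrices of
`R`-linear maps, with support in the preimage under `p × id` of a set in `ℰ_{Gcc}^X`.
`coeff a b` is the component `φ_a^b : A_a → B_b`. -/
@[ext]
structure Obstr.Hom (A B : Obstr R G p) where
  /-- the component from `a` to `b` -/
  coeff : ∀ a b : Y × Ray, A.mod a ⟶ B.mod b
  finite_source : ∀ b, {a | coeff a b ≠ 0}.Finite
  finite_target : ∀ a, {b | coeff a b ≠ 0}.Finite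
  invariant : ∀ (g : G) (a b), coeff (actFst g a) (actFst g b) =
    eqToHom (A.invariant g a) ≫ coeff a b ≫ eqToHom (B.invariant g b).symm
  control : ∃ E, IsControlSet G E ∧
    ∀ a b, coeff a b ≠ 0 → ((p a.1, a.2), (p b.1, b.2)) ∈ E

namespace Obstr

/-- The action of `g` as a bijection. -/
def actEquiv (g : G) : (Y × Ray) ≃ (Y × Ray) where
  toFun := actFst g
  invFun := actFst g⁻¹
  left_inv a := by simp [actFst]
  right_inv a := by simp [actFst]

open Classical in
/-- The identity matrix. -/
noncomputable def idHom (A : Obstr R G p) : Hom A A where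
  coeff a b := if h : a = b then eqToHom (congrArg A.mod h) else 0
  finite_source b := (Set.finite_singleton b).subset fun a ha => by
    by_contra h
    exact ha (dif_neg h)
  finite_target a := (Set.finite_singleton a).subset fun b hb => by
    by_contra h
    exact hb (dif_neg fun h' => h h'.symm)
  invariant g a b := by
    by_cases h : a = b
    · subst h
      simp
    · have h' : actFst g a ≠ actFst g b := fun h' => h ((actEquiv g).injective h')
      simp [h, h']
  control := ⟨_, IsControlSet.diag, fun a b hab => by
    by_cases h : a = b
    · simp [h]
    · exact absurd (dif_neg h) hab⟩

theorem finite_comp {A B C : Obstr R G p} (φ : Hom A B) (ψ : Hom B C) (a c : Y × Ray) :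
    (Function.support fun b => φ.coeff a b ≫ ψ.coeff b c).Finite :=
  (φ.finite_target a).subset fun b hb h => hb (by simp [h])

theorem exists_of_comp_ne {A B C : Obstr R G p} (φ : Hom A B) (ψ : Hom B C) {a c : Y × Ray}
    (h : ∑ᶠ b, φ.coeff a b ≫ ψ.coeff b c ≠ 0) :
    ∃ b, φ.coeff a b ≠ 0 ∧ ψ.coeff b c ≠ 0 := by
  obtain ⟨b, hb⟩ : ∃ b, φ.coeff a b ≫ ψ.coeff b c ≠ 0 := by
    by_contra! hb
    exact h (by simp [hb])
  exact ⟨b, fun h => hb (by simp [h]), fun h => hb (by simp [h])⟩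

/-- Conjugation by isomorphisms, as an additive map. -/
def conj {M M' N N' : ModuleCat.{u} R} (e : M' ⟶ M) (f : N ⟶ N') : (M ⟶ N) →+ (M' ⟶ N') where
  toFun φ := e ≫ φ ≫ f
  map_zero' := by simp
  map_add' := by simp

/-- Composition is matrix multiplication. -/
noncomputable def compHom {A B C : Obstr R G p} (φ : Hom A B) (ψ : Hom B C) : Hom A C where
  coeff a c := ∑ᶠ b, φ.coeff a b ≫ ψ.coeff b c
  finite_source c := by
    refine ((ψ.finite_source c).biUnion fun b _ => φ.finite_source b).subset fun a ha => ?_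
    obtain ⟨b, h, h'⟩ := exists_of_comp_ne φ ψ ha
    exact Set.mem_biUnion (show b ∈ {b | ψ.coeff b c ≠ 0} from h') h
  finite_target a := by
    refine ((φ.finite_target a).biUnion fun b _ => ψ.finite_target b).subset fun c hc => ?_
    obtain ⟨b, h, h'⟩ := exists_of_comp_ne φ ψ hc
    exact Set.mem_biUnion (show b ∈ {b | φ.coeff a b ≠ 0} from h) h'
  invariant g a c := by
    rw [← finsum_comp_equiv (actEquiv g)]
    change _ = conj _ _ _
    rw [AddMonoidHom.map_finsum _ (finite_comp φ ψ a c)]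
    refine finsum_congr fun b => ?_
    change φ.coeff _ (actFst g b) ≫ ψ.coeff (actFst g b) _ = _ ≫ _ ≫ _
    rw [φ.invariant, ψ.invariant]
    simp
  control := by
    obtain ⟨E, hE, h⟩ := φ.control
    obtain ⟨F, hF, h'⟩ := ψ.control
    refine ⟨_, hE.comp hF, fun a c hac => ?_⟩
    obtain ⟨b, k, k'⟩ := exists_of_comp_ne φ ψ hac
    exact Or.inl ⟨_, h a b k, h' b c k'⟩

noncomputable instance : Category (Obstr R G p) where
  Hom := Hom
  id := idHom
  comp := compHom
  id_comp {A B} φ := by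
    refine Hom.ext (funext fun a => funext fun c => ?_)
    change ∑ᶠ b, (idHom A).coeff a b ≫ φ.coeff b c = _
    rw [finsum_eq_single _ a]
    · simp [idHom]
    · intro b hb
      simp [idHom, hb.symm]
  comp_id {A B} φ := by
    refine Hom.ext (funext fun a => funext fun c => ?_)
    change ∑ᶠ b, φ.coeff a b ≫ (idHom B).coeff b c = _
    rw [finsum_eq_single _ c]
    · simp [idHom]
    · intro b hb
      simp [idHom, hb]
  assoc {A B C D} φ ψ χ := by
    refine Hom.ext (funext fun a => funext fun d => ?_)
    change ∑ᶠ c, (∑ᶠ b, φ.coeff a b ≫ ψ.coeff b c) ≫ χ.coeff c d =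
      ∑ᶠ b, φ.coeff a b ≫ ∑ᶠ c, ψ.coeff b c ≫ χ.coeff c d
    have h₁ : ∀ c, (∑ᶠ b, φ.coeff a b ≫ ψ.coeff b c) ≫ χ.coeff c d =
        ∑ᶠ b, φ.coeff a b ≫ ψ.coeff b c ≫ χ.coeff c d := fun c => by
      have := AddMonoidHom.map_finsum (Preadditive.rightComp _ (χ.coeff c d))
        (finite_comp φ ψ a c)
      exact this
    have h₂ : ∀ b, φ.coeff a b ≫ ∑ᶠ c, ψ.coeff b c ≫ χ.coeff c d =
        ∑ᶠ c, φ.coeff a b ≫ ψ.coeff b c ≫ χ.coeff c d := fun b => by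
      have := AddMonoidHom.map_finsum (Preadditive.leftComp _ (φ.coeff a b))
        (finite_comp ψ χ b d)
      exact this
    simp only [h₁, h₂]
    have hS := φ.finite_target a
    have hT := χ.finite_source d
    have e₁ : ∀ c, ∑ᶠ b, φ.coeff a b ≫ ψ.coeff b c ≫ χ.coeff c d =
        ∑ b ∈ hS.toFinset, φ.coeff a b ≫ ψ.coeff b c ≫ χ.coeff c d := fun c => by
      refine finsum_eq_sum_of_support_subset _ fun b hb => ?_
      simp only [Set.Finite.coe_toFinset]
      exact fun h => hb (by simp [h])
    have e₂ : ∀ b, ∑ᶠ c, φ.coeff a b ≫ ψ.coeff b c ≫ χ.coeff c d =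
        ∑ c ∈ hT.toFinset, φ.coeff a b ≫ ψ.coeff b c ≫ χ.coeff c d := fun b => by
      refine finsum_eq_sum_of_support_subset _ fun c hc => ?_
      simp only [Set.Finite.coe_toFinset]
      exact fun h => hc (by simp [h])
    rw [finsum_eq_sum_of_support_subset (s := hT.toFinset), finsum_eq_sum_of_support_subset
      (s := hS.toFinset)]
    · simp only [e₁, e₂]
      exact Finset.sum_comm
    · intro b hb
      simp only [Set.Finite.coe_toFinset]
      exact fun h => hb (by simp [h])
    · intro c hc
      simp only [Set.Finite.coe_toFinset]
      exact fun h => hc (by simp [h])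

/-- The component `φ_a^b : A_a → B_b` of a morphism. -/
def entry {A B : Obstr R G p} (φ : A ⟶ B) (a b : Y × Ray) : A.mod a ⟶ B.mod b :=
  Hom.coeff φ a b

theorem hom_ext {A B : Obstr R G p} {φ ψ : A ⟶ B} (h : ∀ a b, entry φ a b = entry ψ a b) : φ = ψ :=
  Hom.ext (funext fun a => funext fun b => h a b)

/-- Morphisms are added componentwise. -/
def addHom {A B : Obstr R G p} (φ ψ : Hom A B) : Hom A B where
  coeff a b := φ.coeff a b + ψ.coeff a b
  finite_source b := ((φ.finite_source b).union (ψ.finite_source b)).subset fun a ha => by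
    by_contra h
    simp only [Set.mem_union, Set.mem_ofPred_eq, not_or, not_not] at h
    exact ha (by simp [h.1, h.2])
  finite_target a := ((φ.finite_target a).union (ψ.finite_target a)).subset fun b hb => by
    by_contra h
    simp only [Set.mem_union, Set.mem_ofPred_eq, not_or, not_not] at h
    exact hb (by simp [h.1, h.2])
  invariant g a b := by simp [φ.invariant, ψ.invariant]
  control := by
    obtain ⟨E, hE, h⟩ := φ.control
    obtain ⟨F, hF, h'⟩ := ψ.control
    refine ⟨_, hE.union hF, fun a b hab => ?_⟩
    by_cases k : φ.coeff a b = 0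
    · exact Or.inr (h' a b fun k' => hab (by simp [k, k']))
    · exact Or.inl (h a b k)

/-- The zero morphism. -/
def zeroHom (A B : Obstr R G p) : Hom A B where
  coeff _ _ := 0
  finite_source _ := by simp
  finite_target _ := by simp
  invariant g a b := by simp
  control := ⟨_, IsControlSet.diag, fun _ _ h => absurd rfl h⟩

/-- Morphisms are negated componentwise. -/
def negHom {A B : Obstr R G p} (φ : Hom A B) : Hom A B where
  coeff a b := -φ.coeff a b
  finite_source b := by simpa using φ.finite_source b
  finite_target a := by simpa using φ.finite_target a
  invariant g a b := by simp [φ.invariant]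
  control := by simpa using φ.control

instance (A B : Obstr R G p) : Add (A ⟶ B) := ⟨addHom⟩
instance (A B : Obstr R G p) : Zero (A ⟶ B) := ⟨zeroHom A B⟩
instance (A B : Obstr R G p) : Neg (A ⟶ B) := ⟨negHom⟩

theorem entry_add {A B : Obstr R G p} (φ ψ : A ⟶ B) (a b) :
    entry (φ + ψ) a b = entry φ a b + entry ψ a b := rfl

theorem entry_zero {A B : Obstr R G p} (a b) : entry (0 : A ⟶ B) a b = 0 := rfl

theorem entry_neg {A B : Obstr R G p} (φ : A ⟶ B) (a b) : entry (-φ) a b = -entry φ a b := rfl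

theorem entry_comp {A B C : Obstr R G p} (φ : A ⟶ B) (ψ : B ⟶ C) (a c) :
    entry (φ ≫ ψ) a c = ∑ᶠ b, entry φ a b ≫ entry ψ b c := rfl

instance (A B : Obstr R G p) : AddCommGroup (A ⟶ B) :=
  { AddGroup.ofLeftAxioms
      (fun φ ψ χ => hom_ext fun a b => by simp only [entry_add, add_assoc])
      (fun φ => hom_ext fun a b => by simp only [entry_add, entry_zero, zero_add])
      (fun φ => hom_ext fun a b => by
        simp only [entry_add, entry_zero, entry_neg, neg_add_cancel]) with
    add_comm := fun φ ψ => hom_ext fun a b => by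
      simp only [entry_add, add_comm] }

noncomputable instance : Preadditive (Obstr R G p) where
  add_comp A B C φ φ' ψ := hom_ext fun a c => by
    change ∑ᶠ b, entry (φ + φ') a b ≫ entry ψ b c =
      (∑ᶠ b, entry φ a b ≫ entry ψ b c) + ∑ᶠ b, entry φ' a b ≫ entry ψ b c
    refine Eq.trans ?_ (finsum_add_distrib (finite_comp φ ψ a c) (finite_comp φ' ψ a c))
    refine finsum_congr fun b => ?_
    change (entry φ a b + entry φ' a b) ≫ _ = _
    simp
  comp_add A B C φ ψ ψ' := hom_ext fun a c => by
    change ∑ᶠ b, entry φ a b ≫ entry (ψ + ψ') b c =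
      (∑ᶠ b, entry φ a b ≫ entry ψ b c) + ∑ᶠ b, entry φ a b ≫ entry ψ' b c
    refine Eq.trans ?_ (finsum_add_distrib (finite_comp φ ψ a c) (finite_comp φ ψ' a c))
    refine finsum_congr fun b => ?_
    change _ ≫ (entry ψ b c + entry ψ' b c) = _
    simp

/-- `φ` *restricts to* `I ⊆ X`: the supports of the source and of the target do not meet the part
over `∂I`, and `φ` has no non-zero component between a point over `I` and a point not over `I`. -/
def RestrictsTo (I : Set X) {A B : Obstr R G p} (φ : A ⟶ B) : Prop :=
  (∀ a ∈ A.supp, p a.1 ∉ frontier I) ∧ (∀ b ∈ B.supp, p b.1 ∉ frontier I) ∧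
  ∀ a b : Y × Ray, p a.1 ∈ I → p b.1 ∉ I → entry φ a b = 0 ∧ entry φ b a = 0

end Obstr

end Category

section Size

variable {R : Type u} [Ring R] {G : Type*} [Group G] {X Y : Type*}
  [PseudoMetricSpace X] [MulAction G X] [TopologicalSpace Y] [MulAction G Y] {p : Y → X}

namespace Obstr

/-- `φ` is `ε`-controlled: the horizontal distance, measured in `X`, between any two points joined
by a non-zero component of `φ` is less than `ε`. -/
def IsControlled (ε : ℝ) {A B : Obstr R G p} (φ : A ⟶ B) : Prop :=
  ∀ a b : Y × Ray, entry φ a b ≠ 0 → dist (p a.1) (p b.1) < ε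

/-- `α` is an `ε`-automorphism. -/
def IsEpsAut (ε : ℝ) {A : Obstr R G p} (α : Aut A) : Prop :=
  IsControlled ε α.hom ∧ IsControlled ε α.inv

end Obstr

end Size

/-! ### The two examples -/

/-- The infinite cyclic group `⟨t⟩`, written multiplicatively. -/
abbrev InfCyclic : Type := Multiplicative ℤ

/-- The generator `t` acts on `ℝ` by translation by `1`. -/
instance : MulAction InfCyclic ℝ where
  smul g x := ((Multiplicative.toAdd g : ℤ) : ℝ) + x
  one_smul x := by
    change ((Multiplicative.toAdd (1 : InfCyclic) : ℤ) : ℝ) + x = x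
    simp
  mul_smul g h x := by
    change ((Multiplicative.toAdd (g * h) : ℤ) : ℝ) + x = _ + (_ + x)
    simp [add_assoc]

/-- The infinite dihedral group `⟨r, s ∣ s² = 1, rs = sr⁻¹⟩`; the element `s rⁱ` is `sr i`. -/
abbrev DInf : Type := DihedralGroup 0

/-- The generator `r` acts on `ℝ` by translation by `1` and `s` by `x ↦ -x`. -/
instance : MulAction DInf ℝ where
  smul
    | .r i, x => (i.cast : ℝ) + x
    | .sr i, x => -((i.cast : ℝ) + x)
  one_smul x := by
    change ((0 : ZMod 0).cast : ℝ) + x = x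
    simp
  mul_smul g h x := by
    rcases g with i | i <;> rcases h with j | j
    · change ((i + j : ZMod 0).cast : ℝ) + x = i.cast + (j.cast + x)
      rw [ZMod.cast_add (dvd_refl 0)]; ring
    · change -(((j - i : ZMod 0).cast : ℝ) + x) = i.cast + -(j.cast + x)
      rw [ZMod.cast_sub (dvd_refl 0)]; ring
    · change -(((i + j : ZMod 0).cast : ℝ) + x) = -(i.cast + (j.cast + x))
      rw [ZMod.cast_add (dvd_refl 0)]; ring
    · change ((j - i : ZMod 0).cast : ℝ) + x = -(i.cast + -(j.cast + x))
      rw [ZMod.cast_sub (dvd_refl 0)]; ring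

/-- The action of `D_∞` on `D_∞ / ⟨r⟩ ≅ ℤ/2`: `r` acts trivially and `s` exchanges the two
elements. -/
instance : MulAction DInf (ZMod 2) where
  smul
    | .r _, e => e
    | .sr _, e => e + 1
  one_smul _ := rfl
  mul_smul g h e := by
    rcases g with i | i <;> rcases h with j | j
    · rfl
    · rfl
    · rfl
    · change e = e + 1 + 1
      rw [add_assoc, show (1 + 1 : ZMod 2) = 0 from rfl, add_zero]

variable (R : Type u) [Ring R]

/-- The category `Õ^{⟨t⟩}(ℝ)`. -/
abbrev OTilde := Obstr R InfCyclic (id : ℝ → ℝ)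

/-- The category `𝒪^{D_∞}(ℝ̄)` for the resolution `ℝ̄ = ℤ/2 × ℝ → ℝ`, where `D_∞` acts diagonally
on `ℤ/2 × ℝ` and `ℤ/2` is discrete. -/
abbrev ODInf := Obstr R DInf (Prod.snd : ZMod 2 × ℝ → ℝ)

end ControlledAlgebra

set_option linter.unusedSectionVars false

/-! Call the points n + 1/2 cuts. The automorphism α crosses cuts only near them, and there it is
cancelled by an Eilenberg swindle. To A one adds, for every level k ≥ 1, a copy of the part of A
over a neighbourhood χ of the cuts, raised by k in height and pushed towards the cut (`Frame.pos`).
Raising keeps the infinite sum locally finite. Pushing makes a matrix which changes levels by at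
most one controlled uniformly in k, since both ends of each component lie near the same cut
(`isUniform_shift`).

On this sum α is extended by the identity, which does not change its class (`Decomp.cls_extend`),
and then composed with two products of elementary automorphisms, modelled on Whitehead's
factorization of diag(α, α⁻¹). Well inside χ, the first product is α on the positive even levels and
α⁻¹ on the odd ones; the second is α on the odd levels and α⁻¹ on all even ones, level 0 included.
Elementary automorphisms have class zero (`Decomp.cls_elementary`), so the result `swindle` has the
class of α (`cls_swindle`), while well inside χ everything cancels to the identity (`emb_swindle`).

At the boundary of χ the truncated products are not diagonal and nothing cancels, but only the
absence of crossings matters. `swindle` is a composite of eleven factors, each following at most one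
edge of the graph of points joined by α or α⁻¹. A path that changes its unit cell uses a crossing
edge, so it starts in `cutNbhd α 11` (`isReach_swindle`). With χ = `cutNbhd α 12`, both α and α⁻¹
carry the part over `cutNbhd α 11` into the part over χ, so over `cutNbhd α 11` the result is the
identity. The size 1/30 keeps χ within 13/30 of the cuts, so different cuts do not interact.

Points lying on a cut have to be moved off it equivariantly. Over ℝ this is impossible for D_∞, as a
reflection fixes 1/2; the two sheets of ℤ/2 × ℝ make a consistent choice of sides possible. `Frame`
collects what the two examples share, and `exists_restrictsTo` holds for every frame. -/

namespace ControlledAlgebra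

/-! ### Direct sums and elementary automorphisms in `K₁` -/

section K1

variable {C : Type*} [Category C] [Preadditive C]

theorem K1.cls_mul {X : C} (f g : Aut X) : K1.cls (f * g) = K1.cls f + K1.cls g := by
  rw [K1.cls, K1.cls, K1.cls, ← QuotientAddGroup.mk_add, ← sub_eq_zero, ← QuotientAddGroup.mk_sub,
    QuotientAddGroup.eq_zero_iff]
  exact AddSubgroup.subset_closure (Or.inl ⟨X, f, g, rfl⟩)

theorem K1.cls_one {X : C} : K1.cls (1 : Aut X) = 0 := by
  simpa using K1.cls_mul (1 : Aut X) 1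

theorem K1.cls_of_splitting (S : ShortComplex C) (h : S.Splitting) {f₁ : Aut S.X₁} {f₂ : Aut S.X₂}
    {f₃ : Aut S.X₃} (h₁ : f₁.hom ≫ S.f = S.f ≫ f₂.hom) (h₂ : f₂.hom ≫ S.g = S.g ≫ f₃.hom) :
    K1.cls f₂ = K1.cls f₁ + K1.cls f₃ := by
  rw [K1.cls, K1.cls, K1.cls, ← QuotientAddGroup.mk_add, ← sub_eq_zero, ← QuotientAddGroup.mk_sub,
    QuotientAddGroup.eq_zero_iff]
  exact AddSubgroup.subset_closure (Or.inr ⟨S, f₁, f₂, f₃, ⟨h⟩, h₁, h₂, rfl⟩)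

/-- A direct sum decomposition `B ≅ X ⊕ Z` in a preadditive category. -/
structure Decomp (X B Z : C) where
  /-- the inclusion of the first summand -/
  f : X ⟶ B
  /-- the projection to the first summand -/
  r : B ⟶ X
  /-- the projection to the second summand -/
  g : B ⟶ Z
  /-- the inclusion of the second summand -/
  s : Z ⟶ B
  f_r : f ≫ r = 𝟙 X
  s_g : s ≫ g = 𝟙 Z
  total : r ≫ f + g ≫ s = 𝟙 B

namespace Decomp

variable {X B Z : C} (D : Decomp X B Z)

attribute [simp] f_r s_g

@[simp]
theorem f_r_assoc {W : C} (h : X ⟶ W) : D.f ≫ D.r ≫ h = h := by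
  rw [← Category.assoc, D.f_r, Category.id_comp]

@[simp]
theorem s_g_assoc {W : C} (h : Z ⟶ W) : D.s ≫ D.g ≫ h = h := by
  rw [← Category.assoc, D.s_g, Category.id_comp]

-- Inserting `total` in the middle writes `f ≫ g` as the sum of two copies of itself, so it
-- vanishes. Thus exactness need not be part of the data of a decomposition.
@[simp]
theorem f_g : D.f ≫ D.g = 0 := by
  have h : D.f ≫ (D.r ≫ D.f + D.g ≫ D.s) ≫ D.g = D.f ≫ D.g := by rw [D.total, Category.id_comp]
  simpa using h

@[simp]
theorem s_r : D.s ≫ D.r = 0 := by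
  have h : D.s ≫ (D.r ≫ D.f + D.g ≫ D.s) ≫ D.r = D.s ≫ D.r := by rw [D.total, Category.id_comp]
  simpa using h

@[simp]
theorem f_g_assoc {W : C} (h : Z ⟶ W) : D.f ≫ D.g ≫ h = 0 := by
  rw [← Category.assoc, D.f_g, Limits.zero_comp]

@[simp]
theorem s_r_assoc {W : C} (h : X ⟶ W) : D.s ≫ D.r ≫ h = 0 := by
  rw [← Category.assoc, D.s_r, Limits.zero_comp]

/-- The splitting of the short complex of a direct sum decomposition. -/
def splitting : (ShortComplex.mk D.f D.g D.f_g).Splitting where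
  r := D.r
  s := D.s
  f_r := D.f_r
  s_g := D.s_g
  id := D.total

/-- Extension of an automorphism of the first summand by the identity of the second. -/
@[simps]
def extend (α : Aut X) : Aut B where
  hom := D.r ≫ α.hom ≫ D.f + D.g ≫ D.s
  inv := D.r ≫ α.inv ≫ D.f + D.g ≫ D.s
  hom_inv_id := by
    have h := Iso.hom_inv_id_assoc α D.f
    simp [h, D.total]
  inv_hom_id := by
    have h := Iso.inv_hom_id_assoc α D.f
    simp [h, D.total]

/-- The extension induces the identity on the quotient `Z`, and identities have class zero. -/
theorem cls_extend (α : Aut X) : K1.cls (D.extend α) = K1.cls α := by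
  have h := K1.cls_of_splitting _ D.splitting (f₁ := α) (f₂ := D.extend α) (f₃ := 1)
    (by simp) (by
      change _ = D.g ≫ 𝟙 Z
      simp)
  rw [K1.cls_one, add_zero] at h
  exact h

/-- The elementary automorphism given by a morphism from the second to the first summand. -/
@[simps]
def elementary (z : Z ⟶ X) : Aut B where
  hom := 𝟙 B + D.g ≫ z ≫ D.f
  inv := 𝟙 B - D.g ≫ z ≫ D.f
  hom_inv_id := by simp
  inv_hom_id := by simp

/-- A unipotent automorphism induces the identity on both the subobject and the quotient. -/
theorem cls_elementary (z : Z ⟶ X) : K1.cls (D.elementary z) = 0 := by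
  have h := K1.cls_of_splitting _ D.splitting (f₁ := 1) (f₂ := D.elementary z) (f₃ := 1)
    (by
      change 𝟙 X ≫ D.f = _
      simp)
    (by
      change _ = D.g ≫ 𝟙 Z
      simp)
  rw [K1.cls_one, K1.cls_one, add_zero] at h
  exact h

end Decomp

end K1
-- Continuous control as uniform control
section UniformControl

variable {G X : Type*} [Group G] [PseudoMetricSpace X] [MulAction G X]

/-- A relation on `X × [1, ∞)` is *uniformly controlled* if it is bounded in the direction of
`[1, ∞)` and the horizontal distance of related points tends to zero uniformly with the height. -/
structure IsUniform (Q : X × Ray → X × Ray → Prop) : Prop where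
  bounded : ∃ δ : ℝ, ∀ a b, Q a b → |(a.2 : ℝ) - b.2| ≤ δ
  small : ∀ ε > (0 : ℝ), ∃ T : ℝ, ∀ a b, Q a b → T < (a.2 : ℝ) → T < (b.2 : ℝ) → dist a.1 b.1 < ε

theorem exists_ball_of_isOpen {x : X} {U : Set (X × RayInf)} (hU : IsOpen U)
    (hx : (x, infPt) ∈ U) :
    ∃ r > (0 : ℝ), ∃ M : ℝ, ∀ (y : X) (t : RayInf), dist y x < r → (M : EReal) < t →
      (y, t) ∈ U := by
  obtain ⟨u, v, hu, hv, hxu, hv', huv⟩ := isOpen_prod_iff.1 hU x infPt hx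
  obtain ⟨r, hr, hru⟩ := Metric.isOpen_iff.1 hu x hxu
  obtain ⟨w, hw, rfl⟩ := isOpen_induced_iff.1 hv
  obtain ⟨M, hM⟩ := EReal.mem_nhds_top_iff.1 (hw.mem_nhds (show (⊤ : EReal) ∈ w from hv'))
  exact ⟨r, hr, M, fun y t hy ht => huv ⟨hru hy, hM ht⟩⟩

theorem isInvNhd_box [IsIsometricSMul G X] (x : X) {r : ℝ} (hr : 0 < r) (M : ℝ) :
    IsInvNhd G x {a : X × RayInf | dist a.1 x < r ∧ (M : EReal) < a.2} := by
  refine ⟨?_, ⟨by simpa using hr, EReal.coe_lt_top M⟩, fun g hg a ha => ⟨?_, ha.2⟩⟩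
  · refine IsOpen.inter ?_ ?_
    · exact isOpen_lt (continuous_fst.dist continuous_const) continuous_const
    · exact isOpen_lt continuous_const (continuous_subtype_val.comp continuous_snd)
  · have h : g • x = x := hg
    have h' : dist (g • a.1) (g • x) < r := by
      rw [dist_smul]
      exact ha.1
    rw [h] at h'
    exact h'

/-- The largest relation obeying the same bounds δ and T(ε) as `Q` is symmetric, and it is invariant
because the action is isometric and leaves heights unchanged. Every morphism constructed below
obtains its control condition from here. -/
theorem IsUniform.exists_isControlSet [IsIsometricSMul G X] {Q : X × Ray → X × Ray → Prop}
    (hQ : IsUniform Q) :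
    ∃ E : Set ((X × Ray) × (X × Ray)), IsControlSet G E ∧ ∀ a b, Q a b → (a, b) ∈ E := by
  obtain ⟨⟨δ, hδ⟩, h⟩ := hQ
  choose T hT using h
  refine ⟨{e | |(e.1.2 : ℝ) - e.2.2| ≤ δ ∧ ∀ ε (hε : 0 < ε), T ε hε < (e.1.2 : ℝ) →
    T ε hε < (e.2.2 : ℝ) → dist e.1.1 e.2.1 < ε}, ⟨?_, ⟨δ, fun a b h => h.1⟩, ?_, ?_⟩,
    fun a b hab => ⟨hδ a b hab, fun ε hε => hT ε hε a b hab⟩⟩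
  · intro x U hU
    obtain ⟨r, hr, M, hM⟩ := exists_ball_of_isOpen hU.1 hU.2.1
    have hr2 : 0 < r / 2 := by positivity
    -- A related point may be lower by δ; the summand `|δ|` keeps it above both `M` and the
    -- threshold for `r / 2`. The two halves of `r` then add up by the triangle inequality.
    refine ⟨U ∩ {a | dist a.1 x < r / 2 ∧
      ((max M (T (r / 2) hr2) + |δ| : ℝ) : EReal) < a.2},
      Set.inter_subset_left, hU.inter (isInvNhd_box x hr2 _), ?_⟩
    rintro a b ha ⟨-, hb, hb'⟩ ⟨hab, hab'⟩
    have hb2 : max M (T (r / 2) hr2) + |δ| < (b.2 : ℝ) := EReal.coe_lt_coe_iff.1 hb'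
    have h1 := le_max_left M (T (r / 2) hr2)
    have h2 := le_max_right M (T (r / 2) hr2)
    have h3 := le_abs_self δ
    have h4 := abs_nonneg δ
    simp only at hab hab'
    rw [abs_le] at hab
    have h5 := hab' (r / 2) hr2 (by linarith) (by linarith)
    refine ha (hM _ _ ?_ ?_)
    · have := dist_triangle a.1 b.1 x
      simp only at hb
      linarith
    · change ((M : ℝ) : EReal) < ((a.2 : ℝ) : EReal)
      exact EReal.coe_lt_coe_iff.2 (by linarith)
  · rintro a b ⟨h, h'⟩
    refine ⟨by rw [abs_sub_comm]; exact h, fun ε hε k k' => ?_⟩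
    rw [dist_comm]
    exact h' ε hε k' k
  · rintro g a b ⟨h, h'⟩
    refine ⟨h, fun ε hε k k' => ?_⟩
    change dist (g • a.1) (g • b.1) < ε
    rw [dist_smul]
    exact h' ε hε k k'

/-- Control at each point of the compact set `K` gives a radius and a height; finitely many balls
cover `K`, and invariance of `E` under isometries carries the resulting bound to all of `X`. -/
theorem IsControlSet.isUniform [IsIsometricSMul G X] {E : Set ((X × Ray) × (X × Ray))}
    (hE : IsControlSet G E) {K : Set X} (hK : IsCompact K) (hGK : ∀ x : X, ∃ g : G, g • x ∈ K) :
    IsUniform fun a b => (a, b) ∈ E := by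
  refine ⟨hE.bounded, fun ε hε => ?_⟩
  have h : ∀ x : X, ∃ r > (0 : ℝ), ∃ M : ℝ, ∀ a b : X × Ray, dist b.1 x < r → M < (b.2 : ℝ) →
      (a, b) ∈ E → dist a.1 b.1 < ε := by
    intro x
    obtain ⟨V, hVU, hV, hVE⟩ := hE.continuous_control x _
      (isInvNhd_box x (show 0 < ε / 2 by positivity) 0)
    obtain ⟨r, hr, M, hM⟩ := exists_ball_of_isOpen hV.1 hV.2.1
    refine ⟨r, hr, M, fun a b hb hb' hab => ?_⟩
    have hbV : (b.1, b.2.toInf) ∈ V := hM _ _ hb (EReal.coe_lt_coe_iff.2 hb')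
    have ha := not_imp_not.1 (fun h => hVE a b h hbV) hab
    have h1 : dist b.1 x < ε / 2 := (hVU hbV).1
    have h2 : dist a.1 x < ε / 2 := ha.1
    linarith [dist_triangle_right a.1 b.1 x]
  choose r hr M hM using h
  obtain ⟨t, -, ht⟩ := hK.elim_nhds_subcover (fun x => Metric.ball x (r x))
    fun x _ => Metric.ball_mem_nhds x (hr x)
  classical
  obtain ⟨T, hT⟩ := (t.image M).exists_le
  refine ⟨T, fun a b hab _ hb => ?_⟩
  obtain ⟨g, hg⟩ := hGK b.1
  obtain ⟨x, hx, hgx⟩ := Set.mem_iUnion₂.1 (ht hg)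
  have h := hM x (actFst g a) (actFst g b) hgx
    ((hT _ (Finset.mem_image_of_mem M hx)).trans_lt hb) (hE.invariant g a b hab)
  change dist (g • a.1) (g • b.1) < ε at h
  rwa [dist_smul] at h

theorem IsUniform.mono {Q Q' : X × Ray → X × Ray → Prop} (hQ : IsUniform Q)
    (h : ∀ a b, Q' a b → Q a b) : IsUniform Q' := by
  obtain ⟨⟨δ, hδ⟩, h'⟩ := hQ
  refine ⟨⟨δ, fun a b hab => hδ a b (h a b hab)⟩, fun ε hε => ?_⟩
  obtain ⟨T, hT⟩ := h' ε hε
  exact ⟨T, fun a b hab => hT a b (h a b hab)⟩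

end UniformControl
-- Building objects and matrices from those of a given object
section Charts

variable {R : Type u} [Ring R] {G : Type*} [Group G] {X Y : Type*}
  [TopologicalSpace Y] [MulAction G Y]

section

variable [TopologicalSpace X] [MulAction G X] {p : Y → X}

namespace Obstr

theorem entry_eq_eqToHom {A B : Obstr R G p} (φ : A ⟶ B) {a a' b b' : Y × Ray} (h : a = a')
    (h' : b = b') : entry φ a b =
      eqToHom (congrArg A.mod h) ≫ entry φ a' b' ≫ eqToHom (congrArg B.mod h').symm := by
  subst h h'
  simp

theorem entry_actFst {A B : Obstr R G p} (φ : A ⟶ B) (g : G) (a b : Y × Ray) :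
    entry φ (actFst g a) (actFst g b) =
      eqToHom (A.invariant g a) ≫ entry φ a b ≫ eqToHom (B.invariant g b).symm :=
  Hom.invariant φ g a b

theorem entry_one_self (A : Obstr R G p) (a : Y × Ray) : entry (𝟙 A) a a = 𝟙 _ := by
  change (idHom A).coeff a a = _
  simp [idHom]

theorem entry_one_of_ne (A : Obstr R G p) {a b : Y × Ray} (h : a ≠ b) : entry (𝟙 A) a b = 0 :=
  dif_neg h

theorem entry_comp_of_left {A B C : Obstr R G p} (φ : A ⟶ B) (ψ : B ⟶ C) {a b c : Y × Ray}
    (h : ∀ b', b' ≠ b → entry φ a b' = 0) : entry (φ ≫ ψ) a c = entry φ a b ≫ entry ψ b c := by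
  rw [entry_comp]
  refine finsum_eq_single _ b fun b' hb' => ?_
  simp [h b' hb']

theorem entry_comp_of_right {A B C : Obstr R G p} (φ : A ⟶ B) (ψ : B ⟶ C) {a b c : Y × Ray}
    (h : ∀ b', b' ≠ b → entry ψ b' c = 0) : entry (φ ≫ ψ) a c = entry φ a b ≫ entry ψ b c := by
  rw [entry_comp]
  refine finsum_eq_single _ b fun b' hb' => ?_
  simp [h b' hb']

theorem exists_of_entry_comp_ne {A B C : Obstr R G p} (φ : A ⟶ B) (ψ : B ⟶ C) {a c : Y × Ray}
    (h : entry (φ ≫ ψ) a c ≠ 0) : ∃ b, entry φ a b ≠ 0 ∧ entry ψ b c ≠ 0 :=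
  exists_of_comp_ne φ ψ h

theorem eq_or_of_entry_add_ne {A B : Obstr R G p} {φ ψ : A ⟶ B} {a b : Y × Ray}
    (h : entry (φ + ψ) a b ≠ 0) : entry φ a b ≠ 0 ∨ entry ψ a b ≠ 0 := by
  by_contra! h'
  exact h (by rw [entry_add, h'.1, h'.2, add_zero])

theorem eq_of_entry_one_ne {A : Obstr R G p} {a b : Y × Ray} (h : entry (𝟙 A) a b ≠ 0) : a = b := by
  by_contra h'
  exact h (entry_one_of_ne A h')

end Obstr

/-- A *chart* of `B` over `A`: an identification of the modules of `B` over the points of an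
invariant set `dom` with modules of `A`, while the modules of `B` over all other points vanish. -/
structure Chart (A B : Obstr R G p) where
  /-- the point of the support of `A` -/
  f : Y × Ray → Y × Ray
  /-- the domain -/
  dom : Set (Y × Ray)
  f_act : ∀ (g : G) b, f (actFst g b) = actFst g (f b)
  dom_act : ∀ (g : G) b, actFst g b ∈ dom ↔ b ∈ dom
  /-- the identification -/
  down : ∀ b, B.mod b ⟶ A.mod (f b)
  /-- the inverse of the identification -/
  up : ∀ b, A.mod (f b) ⟶ B.mod b
  down_up : ∀ b, down b ≫ up b = 𝟙 _
  up_down : ∀ b ∈ dom, up b ≫ down b = 𝟙 _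
  down_eq_zero : ∀ b ∉ dom, down b = 0
  down_act : ∀ (g : G) b, down (actFst g b) = eqToHom (B.invariant g b) ≫ down b ≫
    eqToHom (by rw [f_act, A.invariant])
  up_act : ∀ (g : G) b, up (actFst g b) = eqToHom (by rw [f_act, A.invariant]) ≫ up b ≫
    eqToHom (B.invariant g b).symm

namespace Chart

variable {A B B' : Obstr R G p}

theorem up_eq_zero (c : Chart A B) {b : Y × Ray} (hb : b ∉ c.dom) : c.up b = 0 := by
  have h : c.up b ≫ c.down b ≫ c.up b = c.up b := by rw [c.down_up, Category.comp_id]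
  rw [← h, c.down_eq_zero b hb]
  simp

theorem mem_dom_of_entry_left_ne (c : Chart A B) {φ : B ⟶ B'} {b b' : Y × Ray}
    (h : Obstr.entry φ b b' ≠ 0) : b ∈ c.dom := by
  by_contra hb
  refine h ?_
  rw [← Category.id_comp (Obstr.entry φ b b'), ← c.down_up, c.down_eq_zero b hb]
  simp

theorem mem_dom_of_entry_right_ne (c : Chart A B) {φ : B' ⟶ B} {b b' : Y × Ray}
    (h : Obstr.entry φ b b' ≠ 0) : b' ∈ c.dom := by
  by_contra hb
  refine h ?_
  rw [← Category.comp_id (Obstr.entry φ b b'), ← c.down_up, c.down_eq_zero b' hb]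
  simp

/-- The identity chart. -/
def refl (A : Obstr R G p) : Chart A A where
  f := id
  dom := Set.univ
  f_act _ _ := rfl
  dom_act _ _ := Iff.rfl
  down _ := 𝟙 _
  up _ := 𝟙 _
  down_up _ := Category.comp_id _
  up_down _ _ := Category.comp_id _
  down_eq_zero _ h := absurd trivial h
  down_act _ _ := by simp
  up_act _ _ := by simp

end Chart

/-- The object with the module `A.mod (f b)` over the points `b` of `S` and zero elsewhere. -/
noncomputable def Obstr.pull (A : Obstr R G p) (f : Y × Ray → Y × Ray) (S : Set (Y × Ray))
    (f_act : ∀ (g : G) b, f (actFst g b) = actFst g (f b))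
    (S_act : ∀ (g : G) b, actFst g b ∈ S ↔ b ∈ S)
    (lf : ∀ a, ∃ U : Set (Y × Ray), IsOpen U ∧ a ∈ U ∧
      (U ∩ {b | b ∈ S ∧ Nontrivial (A.mod (f b))}).Finite)
    (cc : ∃ K : Set Y, IsCompact K ∧ ∀ y, ∃ g : G, ∃ k ∈ K, y = g • k) : Obstr R G p :=
  open Classical in
  { mod := fun b => if b ∈ S then A.mod (f b) else ModuleCat.of R PUnit.{u + 1}
    free := fun b => by
      by_cases h : b ∈ S
      · rw [if_pos h]
        exact A.free _
      · rw [if_neg h]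
        change Module.Free R PUnit.{u + 1}
        infer_instance
    finite := fun b => by
      by_cases h : b ∈ S
      · rw [if_pos h]
        exact A.finite _
      · rw [if_neg h]
        change Module.Finite R PUnit.{u + 1}
        infer_instance
    invariant := fun g b => by
      by_cases h : b ∈ S
      · rw [if_pos h, if_pos ((S_act g b).2 h), f_act, A.invariant]
      · rw [if_neg h, if_neg (mt (S_act g b).1 h)]
    locallyFinite := fun a => by
      obtain ⟨U, hU, haU, h⟩ := lf a
      refine ⟨U, hU, haU, h.subset fun b hb => ⟨hb.1, ?_⟩⟩
      have h' := hb.2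
      rw [Set.mem_ofPred_eq] at h'
      by_cases hbS : b ∈ S
      · rw [if_pos hbS] at h'
        exact ⟨hbS, h'⟩
      · rw [if_neg hbS] at h'
        exact absurd h' (not_nontrivial PUnit)
    cocompact := by
      obtain ⟨K, hK, h⟩ := cc
      exact ⟨K, hK, fun a _ => h a.1⟩ }

section

variable {A : Obstr R G p} {f : Y × Ray → Y × Ray} {S : Set (Y × Ray)}
  {f_act : ∀ (g : G) b, f (actFst g b) = actFst g (f b)}
  {S_act : ∀ (g : G) b, actFst g b ∈ S ↔ b ∈ S}
  {lf : ∀ a, ∃ U : Set (Y × Ray), IsOpen U ∧ a ∈ U ∧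
    (U ∩ {b | b ∈ S ∧ Nontrivial (A.mod (f b))}).Finite}
  {cc : ∃ K : Set Y, IsCompact K ∧ ∀ y, ∃ g : G, ∃ k ∈ K, y = g • k}

theorem Obstr.pull_mod_of_mem {b : Y × Ray} (h : b ∈ S) :
    (A.pull f S f_act S_act lf cc).mod b = A.mod (f b) := if_pos h

theorem Obstr.isZero_pull_mod {b : Y × Ray} (h : b ∉ S) :
    Limits.IsZero ((A.pull f S f_act S_act lf cc).mod b) := by
  have h' : (A.pull f S f_act S_act lf cc).mod b = ModuleCat.of R PUnit.{u + 1} := if_neg h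
  rw [h']
  exact ModuleCat.isZero_of_subsingleton _

end

open Classical in
/-- The tautological chart of `A.pull f S`. -/
noncomputable def Chart.pull (A : Obstr R G p) (f : Y × Ray → Y × Ray) (S : Set (Y × Ray))
    (f_act : ∀ (g : G) b, f (actFst g b) = actFst g (f b))
    (S_act : ∀ (g : G) b, actFst g b ∈ S ↔ b ∈ S)
    (lf : ∀ a, ∃ U : Set (Y × Ray), IsOpen U ∧ a ∈ U ∧
      (U ∩ {b | b ∈ S ∧ Nontrivial (A.mod (f b))}).Finite)
    (cc : ∃ K : Set Y, IsCompact K ∧ ∀ y, ∃ g : G, ∃ k ∈ K, y = g • k) :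
    Chart A (A.pull f S f_act S_act lf cc) where
  f := f
  dom := S
  f_act := f_act
  dom_act := S_act
  down b := if h : b ∈ S then eqToHom (Obstr.pull_mod_of_mem h) else 0
  up b := if h : b ∈ S then eqToHom (Obstr.pull_mod_of_mem h).symm else 0
  down_up b := by
    by_cases h : b ∈ S
    · simp [h]
    · exact (Obstr.isZero_pull_mod h).eq_of_src _ _
  up_down b h := by simp [h]
  down_eq_zero b h := dif_neg h
  down_act g b := by
    by_cases h : b ∈ S
    · have h' := (S_act g b).2 h
      simp [h, h']
    · have h' := mt (S_act g b).1 h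
      simp [h, h']
  up_act g b := by
    by_cases h : b ∈ S
    · have h' := (S_act g b).2 h
      simp [h, h']
    · have h' := mt (S_act g b).1 h
      simp [h, h']

end

section

variable [PseudoMetricSpace X] [MulAction G X] {p : Y → X} {A B B' B'' : Obstr R G p}

open Classical in
/-- The morphism between two objects with charts over `A` with components those of an
endomorphism `φ` of `A`, restricted to an invariant relation `D`. -/
noncomputable def Chart.hom [IsIsometricSMul G X] (c : Chart A B) (c' : Chart A B') (φ : A ⟶ A)
    (D : Y × Ray → Y × Ray → Prop)
    (D_act : ∀ (g : G) b b', D (actFst g b) (actFst g b') ↔ D b b')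
    (fin_left : ∀ b' a, {b | D b b' ∧ b ∈ c.dom ∧ c.f b = a}.Finite)
    (fin_right : ∀ b a, {b' | D b b' ∧ b' ∈ c'.dom ∧ c'.f b' = a}.Finite)
    (control : IsUniform fun x x' => ∃ b b', D b b' ∧ b ∈ c.dom ∧ b' ∈ c'.dom ∧
      Obstr.entry φ (c.f b) (c'.f b') ≠ 0 ∧ x = (p b.1, b.2) ∧ x' = (p b'.1, b'.2)) :
    B ⟶ B' :=
  have key : ∀ {b b'}, (if D b b' then c.down b ≫ Obstr.entry φ (c.f b) (c'.f b') ≫ c'.up b'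
      else 0) ≠ 0 → D b b' ∧ b ∈ c.dom ∧ b' ∈ c'.dom ∧
        Obstr.entry φ (c.f b) (c'.f b') ≠ 0 := fun {b b'} h => by
    by_cases hD : D b b'
    · rw [if_pos hD] at h
      refine ⟨hD, ?_, ?_, fun h' => h (by simp [h'])⟩
      · by_contra h'
        exact h (by simp [c.down_eq_zero b h'])
      · by_contra h'
        exact h (by simp [c'.up_eq_zero h'])
    · exact absurd (if_neg hD) h
  Obstr.Hom.mk
    (fun b b' => if D b b' then c.down b ≫ Obstr.entry φ (c.f b) (c'.f b') ≫ c'.up b' else 0)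
    -- A column of φ has finitely many non-zero entries, and each of their sources has finitely many
    -- preimages related to `b'`.
    (fun b' => ((Obstr.Hom.finite_source φ (c'.f b')).biUnion fun a _ => fin_left b' a).subset
      fun b hb => Set.mem_biUnion (key hb).2.2.2 ⟨(key hb).1, (key hb).2.1, rfl⟩)
    (fun b => ((Obstr.Hom.finite_target φ (c.f b)).biUnion fun a _ => fin_right b a).subset
      fun b' hb => Set.mem_biUnion (key hb).2.2.2 ⟨(key hb).1, (key hb).2.2.1, rfl⟩)
    (fun g b b' => by
      by_cases h : D b b'
      · rw [if_pos h, if_pos ((D_act g b b').2 h), c.down_act, c'.up_act,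
          Obstr.entry_eq_eqToHom φ (c.f_act g b) (c'.f_act g b'), Obstr.entry_actFst]
        simp
      · rw [if_neg h, if_neg (mt (D_act g b b').1 h)]
        simp)
    (by
      obtain ⟨E, hE, h⟩ := control.exists_isControlSet (G := G)
      exact ⟨E, hE, fun b b' hb => h _ _
        ⟨b, b', (key hb).1, (key hb).2.1, (key hb).2.2.1, (key hb).2.2.2, rfl, rfl⟩⟩)

end

end Charts
-- Placing the copies near the cuts
section Geometry

/-- A `G`-space over the real line on which `G` acts by translations and reflections
`x ↦ o g * x + n g`, together with horizontal transport `put` and a choice `eps` of the sides of the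
points. -/
structure Frame (G : Type*) [Group G] [MulAction G ℝ] {Y : Type*} [TopologicalSpace Y]
    [MulAction G Y] (p : Y → ℝ) where
  /-- the orientation character -/
  o : G → ℝ
  /-- the translation -/
  n : G → ℤ
  o_eq : ∀ g, o g = 1 ∨ o g = -1
  smul_eq : ∀ (g : G) (x : ℝ), g • x = o g * x + n g
  p_smul : ∀ (g : G) y, p (g • y) = g • p y
  /-- horizontal transport -/
  put : Y → ℝ → Y
  p_put : ∀ y x, p (put y x) = x
  put_p : ∀ y, put y (p y) = y
  put_put : ∀ y x x', put (put y x) x' = put y x'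
  smul_put : ∀ (g : G) y x, g • put y x = put (g • y) (g • x)
  /-- the preferred side -/
  eps : Y → ℝ
  eps_eq : ∀ y, eps y = 1 ∨ eps y = -1
  eps_smul : ∀ (g : G) y, eps (g • y) = o g * eps y
  translation : ∀ m : ℤ, ∃ g : G, ∀ x : ℝ, g • x = x + m
  continuous_p : Continuous p
  proper : ∀ r s : ℝ, IsCompact (p ⁻¹' Set.Icc r s)

/-- The distance from the cut of the `k`-th copy at height `t` of a point at distance `D`. -/
noncomputable def mag (k : ℕ) (t D : ℝ) : ℝ :=
  if k = 0 then 1 / (8 * t) + (1 - 2 * (1 / (8 * t))) * D else (k + D) / (8 * t ^ 2)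

theorem inv_eight_mul_bounds {t : ℝ} (ht : 1 ≤ t) : 0 < 1 / (8 * t) ∧ 1 / (8 * t) ≤ 1 / 8 := by
  refine ⟨by positivity, ?_⟩
  rw [div_le_div_iff₀ (by positivity) (by norm_num)]
  linarith

/-- Here `t` is the height of the copy, at least `1 + k` because level `k` is raised by `k`. Hence
`k + D < t`, and all positive levels fit in the strip of width `1 / (8 * t)` around the cut which
level 0 vacates. -/
theorem mag_lt_of_ne_zero {k : ℕ} (hk : k ≠ 0) {t D : ℝ} (ht : 1 + k ≤ t) (hD : D < 1 / 2) :
    mag k t D < 1 / (8 * t) := by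
  have hk' : (0 : ℝ) ≤ k := Nat.cast_nonneg k
  have ht' : 0 < t := by linarith
  rw [mag, if_neg hk, div_lt_div_iff₀ (by positivity) (by positivity)]
  have : (k + D) * t < 1 * t * t := by
    have : k + D < 1 * t := by linarith
    exact mul_lt_mul_of_pos_right this ht'
  nlinarith

theorem le_mag_zero {t D : ℝ} (ht : 1 ≤ t) (hD : 0 ≤ D) : 1 / (8 * t) ≤ mag 0 t D := by
  obtain ⟨h, h'⟩ := inv_eight_mul_bounds ht
  rw [mag, if_pos rfl]
  have : 0 ≤ (1 - 2 * (1 / (8 * t))) * D := mul_nonneg (by linarith) hD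
  linarith

theorem mag_pos {k : ℕ} {t D : ℝ} (ht : 1 + k ≤ t) (hD : 0 ≤ D) : 0 < mag k t D := by
  have hk' : (0 : ℝ) ≤ k := Nat.cast_nonneg k
  by_cases hk : k = 0
  · subst hk
    have ht' : 1 ≤ t := by simpa using ht
    exact (inv_eight_mul_bounds ht').1.trans_le (le_mag_zero ht' hD)
  · have : (0 : ℝ) < k := by exact_mod_cast Nat.pos_of_ne_zero hk
    have ht' : 0 < t := by linarith
    rw [mag, if_neg hk]
    positivity

theorem mag_lt_half {k : ℕ} {t D : ℝ} (ht : 1 + k ≤ t) (hD' : D < 1 / 2) :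
    mag k t D < 1 / 2 := by
  have hk' : (0 : ℝ) ≤ k := Nat.cast_nonneg k
  obtain ⟨h, h'⟩ := inv_eight_mul_bounds (show 1 ≤ t by linarith)
  by_cases hk : k = 0
  · rw [mag, if_pos hk]
    nlinarith
  · linarith [mag_lt_of_ne_zero hk ht hD']

theorem mag_zero_sub {t D : ℝ} (ht : 1 ≤ t) (hD : 0 ≤ D) (hD' : D < 1 / 2) :
    |mag 0 t D - D| ≤ 1 / t := by
  obtain ⟨h, h'⟩ := inv_eight_mul_bounds ht
  have h1 : 1 / t = 8 * (1 / (8 * t)) := by field_simp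
  rw [mag, if_pos rfl, h1, abs_le]
  constructor <;> nlinarith

/-- At a fixed height the levels occupy disjoint ranges: level `k ≥ 1` has `k + D` in [k, k + 1/2)
after scaling, and level 0 starts where the strip of the positive levels ends. -/
theorem mag_injective {k k' : ℕ} {t D D' : ℝ} (ht : 1 + k ≤ t) (ht' : 1 + k' ≤ t) (hD : 0 ≤ D)
    (hD' : 0 ≤ D') (hd : D < 1 / 2) (hd' : D' < 1 / 2) (h : mag k t D = mag k' t D') :
    k = k' ∧ D = D' := by
  have hk0 : (0 : ℝ) ≤ k := Nat.cast_nonneg k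
  have ht0 : 1 ≤ t := by linarith
  obtain ⟨h1, h2⟩ := inv_eight_mul_bounds ht0
  by_cases hk : k = 0
  · by_cases hk' : k' = 0
    · subst hk hk'
      refine ⟨rfl, ?_⟩
      rw [mag, mag, if_pos rfl, if_pos rfl, add_right_inj] at h
      exact mul_left_cancel₀ (by linarith) h
    · subst hk
      have := le_mag_zero ht0 hD
      have := mag_lt_of_ne_zero hk' ht' hd'
      linarith
  · by_cases hk' : k' = 0
    · subst hk'
      have := le_mag_zero ht0 hD'
      have := mag_lt_of_ne_zero hk ht hd
      linarith
    · rw [mag, mag, if_neg hk, if_neg hk', div_left_inj' (by positivity)] at h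
      have h3 : (k : ℝ) < k' + 1 := by linarith
      have h4 : (k' : ℝ) < k + 1 := by linarith
      have h5 : k < k' + 1 := by exact_mod_cast h3
      have h6 : k' < k + 1 := by exact_mod_cast h4
      have h7 : k = k' := by omega
      subst h7
      exact ⟨rfl, by linarith⟩

namespace Frame

variable {G : Type*} [Group G] [MulAction G ℝ] {Y : Type*} [TopologicalSpace Y]
  [MulAction G Y] {p : Y → ℝ} (F : Frame G p)

/-- The side of the cut on which a point lies. -/
noncomputable def side (y : Y) : ℝ :=
  if Int.fract (p y) = 1 / 2 then F.eps y else if 1 / 2 < Int.fract (p y) then 1 else -1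

theorem side_eq (y : Y) : F.side y = 1 ∨ F.side y = -1 := by
  unfold side
  split_ifs
  · exact F.eps_eq y
  · exact Or.inl rfl
  · exact Or.inr rfl

theorem side_mul_abs (y : Y) : F.side y * |Int.fract (p y) - 1 / 2| = Int.fract (p y) - 1 / 2 := by
  unfold side
  split_ifs with h h'
  · simp [h]
  · rw [abs_of_pos (by linarith), one_mul]
  · rw [abs_of_nonpos (by linarith)]
    ring

/-- The horizontal coordinate of the `k`-th copy of a point. -/
noncomputable def newX (k : ℕ) (a : Y × Ray) : ℝ :=
  if Int.fract (p a.1) = 0 then p a.1 else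
    ⌊p a.1⌋ + 1 / 2 + F.side a.1 * mag k (a.2 + k) |Int.fract (p a.1) - 1 / 2|

theorem abs_fract_lt {x : ℝ} (h : Int.fract x ≠ 0) : |Int.fract x - 1 / 2| < 1 / 2 := by
  have h1 := Int.fract_lt_one x
  have h2 := lt_of_le_of_ne (Int.fract_nonneg x) h.symm
  rw [abs_lt]
  constructor <;> linarith

theorem one_add_le (k : ℕ) (a : Y × Ray) : (1 : ℝ) + k ≤ a.2 + k := by
  have : (1 : ℝ) ≤ a.2 := a.2.2
  linarith

/-- A reflection sends the fractional part f to 1 - f and so exchanges the two sides of a cut. On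
the cut itself the side is decided by `eps`, whose equivariance is exactly what is needed. -/
theorem side_smul (g : G) {y : Y} (h : Int.fract (p y) ≠ 0) :
    F.side (g • y) = F.o g * F.side y ∧
      Int.fract (p (g • y)) - 1 / 2 = F.o g * (Int.fract (p y) - 1 / 2) ∧
      (⌊p (g • y)⌋ + 1 / 2 : ℝ) = F.o g * (⌊p y⌋ + 1 / 2) + F.n g := by
  rcases F.o_eq g with ho | ho
  · have hx : p (g • y) = p y + F.n g := by rw [F.p_smul, F.smul_eq, ho, one_mul]
    refine ⟨?_, ?_, ?_⟩
    · simp only [side, hx, Int.fract_add_intCast, F.eps_smul, ho, one_mul]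
    · rw [hx, Int.fract_add_intCast, ho, one_mul]
    · rw [hx, Int.floor_add_intCast, ho]
      push_cast
      ring
  · have hx : p (g • y) = -p y + F.n g := by rw [F.p_smul, F.smul_eq, ho, neg_one_mul]
    have hf : Int.fract (p (g • y)) = 1 - Int.fract (p y) := by
      rw [hx, Int.fract_add_intCast, Int.fract_neg h]
    refine ⟨?_, ?_, ?_⟩
    · simp only [side, hf, F.eps_smul, ho]
      by_cases h1 : Int.fract (p y) = 1 / 2
      · rw [if_pos h1, if_pos (by linarith)]
      · rw [if_neg h1, if_neg (fun h2 => h1 (by linarith))]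
        by_cases h2 : 1 / 2 < Int.fract (p y)
        · rw [if_pos h2, if_neg (by linarith)]
          norm_num
        · have h3 : Int.fract (p y) < 1 / 2 := lt_of_le_of_ne (not_lt.1 h2) h1
          rw [if_neg h2, if_pos (by linarith)]
          norm_num
    · rw [hf, ho]
      ring
    · have h1 := Int.floor_add_fract (p (g • y))
      have h2 := Int.floor_add_fract (p y)
      rw [ho]
      linarith

theorem fract_smul_eq_zero (F : Frame G p) (g : G) {y : Y} (h : Int.fract (p y) = 0) :
    Int.fract (p (g • y)) = 0 := by
  obtain ⟨m, hm⟩ := Int.fract_eq_zero_iff.1 h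
  rw [F.p_smul, F.smul_eq, ← hm]
  rcases F.o_eq g with ho | ho
  · rw [ho, one_mul, ← Int.cast_add, Int.fract_intCast]
  · rw [ho, neg_one_mul, ← Int.cast_neg, ← Int.cast_add, Int.fract_intCast]

/-- Integer points are left in place because `side` is not equivariant there: it is always -1,
although a reflection may fix the point. -/
theorem newX_act (k : ℕ) (g : G) (a : Y × Ray) : F.newX k (actFst g a) = g • F.newX k a := by
  unfold newX
  change (if Int.fract (p (g • a.1)) = 0 then p (g • a.1) else ⌊p (g • a.1)⌋ + 1 / 2 +
    F.side (g • a.1) * mag k (a.2 + k) |Int.fract (p (g • a.1)) - 1 / 2|) = _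
  by_cases h : Int.fract (p a.1) = 0
  · rw [if_pos h, if_pos (F.fract_smul_eq_zero g h), F.p_smul]
  · obtain ⟨h1, h2, h3⟩ := F.side_smul g h
    have h4 : Int.fract (p (g • a.1)) ≠ 0 := fun h4 => by
      have := F.fract_smul_eq_zero g⁻¹ h4
      rw [inv_smul_smul] at this
      exact h this
    rw [if_neg h, if_neg h4, h1, h2, h3, F.smul_eq, abs_mul,
      show |F.o g| = 1 by rcases F.o_eq g with ho | ho <;> simp [ho], one_mul]
    ring

/-- The position of the `k`-th copy of a point. -/
noncomputable def pos (k : ℕ) (a : Y × Ray) : Y × Ray :=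
  (F.put a.1 (F.newX k a), ⟨a.2 + k, by
    have h : (1 : ℝ) ≤ a.2 := a.2.2
    have h' : (0 : ℝ) ≤ k := Nat.cast_nonneg k
    exact Set.mem_Ici.2 (by linarith)⟩)

theorem p_pos (k : ℕ) (a : Y × Ray) : p (F.pos k a).1 = F.newX k a := F.p_put _ _

theorem pos_snd (k : ℕ) (a : Y × Ray) : ((F.pos k a).2 : ℝ) = a.2 + k := rfl

theorem pos_act (k : ℕ) (g : G) (a : Y × Ray) : F.pos k (actFst g a) = actFst g (F.pos k a) := by
  unfold pos
  rw [F.newX_act]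
  exact Prod.ext (F.smul_put _ _ _).symm rfl

/-- The interval of length one centered at an integer to which the copies of a point belong. -/
noncomputable def cell (a : Y × Ray) : ℤ :=
  ⌊p a.1⌋ + if Int.fract (p a.1) = 0 then 0 else if F.side a.1 = 1 then 1 else 0

theorem newX_mem (k : ℕ) (a : Y × Ray) : |F.newX k a - F.cell a| < 1 / 2 := by
  unfold newX cell
  have h0 := Int.floor_add_fract (p a.1)
  by_cases h : Int.fract (p a.1) = 0
  · rw [if_pos h, if_pos h, abs_lt]
    rw [h] at h0
    push_cast
    constructor <;> linarith
  · rw [if_neg h, if_neg h]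
    have h1 := mag_pos (one_add_le k a) (abs_nonneg (Int.fract (p a.1) - 1 / 2))
    have h2 := mag_lt_half (one_add_le k a) (abs_fract_lt h)
    rcases F.side_eq a.1 with hs | hs
    · rw [hs, if_pos rfl, abs_lt]
      push_cast
      constructor <;> linarith
    · rw [hs, if_neg (by norm_num), abs_lt]
      push_cast
      constructor <;> linarith

theorem abs_sub_cell_le (a : Y × Ray) : |p a.1 - F.cell a| ≤ 1 / 2 := by
  unfold cell
  have h0 := Int.floor_add_fract (p a.1)
  have h3 := F.side_mul_abs a.1
  have h4 := abs_nonneg (Int.fract (p a.1) - 1 / 2)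
  by_cases h : Int.fract (p a.1) = 0
  · rw [if_pos h, abs_le]
    rw [h] at h0
    push_cast
    constructor <;> linarith
  · have h2 := abs_fract_lt h
    rw [if_neg h]
    rcases F.side_eq a.1 with hs | hs
    · rw [hs] at h3
      rw [hs, if_pos rfl, abs_le]
      push_cast
      constructor <;> linarith
    · rw [hs] at h3
      rw [hs, if_neg (by norm_num), abs_le]
      push_cast
      constructor <;> linarith

/-- The end of the cell of `a` facing `a'` is a cut lying between the two points. -/
theorem exists_cut_of_cell_ne {a a' : Y × Ray} (h : F.cell a ≠ F.cell a') :
    ∃ n : ℤ, |p a.1 - (n + 1 / 2)| ≤ |p a.1 - p a'.1| := by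
  have h1 := abs_le.1 (F.abs_sub_cell_le a)
  have h2 := abs_le.1 (F.abs_sub_cell_le a')
  rcases lt_or_gt_of_ne h with h | h
  · have h' : (F.cell a : ℝ) + 1 ≤ F.cell a' := by exact_mod_cast h
    refine ⟨F.cell a, ?_⟩
    rw [abs_of_nonpos (by linarith), abs_of_nonpos (by linarith)]
    linarith
  · have h' : (F.cell a' : ℝ) + 1 ≤ F.cell a := by exact_mod_cast h
    refine ⟨F.cell a - 1, ?_⟩
    push_cast
    rw [abs_of_nonneg (by linarith), abs_of_nonneg (by linarith)]
    linarith

theorem newX_mem_Ioo_iff (k : ℕ) (a : Y × Ray) :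
    F.newX k a ∈ Set.Ioo (1 / 2 : ℝ) (3 / 2) ↔ F.cell a = 1 := by
  have h := abs_lt.1 (F.newX_mem k a)
  constructor
  · rintro ⟨h1, h2⟩
    have h3 : (F.cell a : ℝ) < 2 := by linarith
    have h4 : (0 : ℝ) < F.cell a := by linarith
    have h5 : F.cell a < 2 := by exact_mod_cast h3
    have h6 : 0 < F.cell a := by exact_mod_cast h4
    omega
  · intro h'
    rw [h'] at h
    push_cast at h
    constructor <;> linarith

theorem newX_ne (k : ℕ) (a : Y × Ray) (m : ℤ) : F.newX k a ≠ m + 1 / 2 := by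
  intro h
  have h' := abs_lt.1 (F.newX_mem k a)
  rw [h] at h'
  have h3 : (F.cell a : ℝ) < m + 1 := by linarith
  have h4 : (m : ℝ) < F.cell a := by linarith
  have h5 : F.cell a < m + 1 := by exact_mod_cast h3
  have h6 : m < F.cell a := by exact_mod_cast h4
  omega

theorem abs_newX_sub_le_one (k : ℕ) (a : Y × Ray) : |F.newX k a - p a.1| ≤ 1 := by
  have h1 := F.newX_mem k a
  have h2 := F.abs_sub_cell_le a
  rw [abs_lt] at h1
  rw [abs_le] at h2 ⊢
  constructor <;> linarith

theorem abs_newX_zero_sub_le (a : Y × Ray) : |F.newX 0 a - p a.1| ≤ 1 / (a.2 : ℝ) := by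
  have ht : (1 : ℝ) ≤ a.2 := a.2.2
  have ht' : (0 : ℝ) < a.2 := by linarith
  unfold newX
  by_cases h : Int.fract (p a.1) = 0
  · rw [if_pos h, sub_self, abs_zero]
    positivity
  · rw [if_neg h]
    have h1 := Int.floor_add_fract (p a.1)
    have h2 := F.side_mul_abs a.1
    have h3 := mag_zero_sub ht (abs_nonneg _) (abs_fract_lt h)
    have h4 : (⌊p a.1⌋ : ℝ) + 1 / 2 +
        F.side a.1 * mag 0 (a.2 + (0 : ℕ)) |Int.fract (p a.1) - 1 / 2| - p a.1 =
        F.side a.1 * (mag 0 a.2 |Int.fract (p a.1) - 1 / 2| - |Int.fract (p a.1) - 1 / 2|) := by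
      rw [mul_sub, h2, Nat.cast_zero, add_zero]
      linarith
    rw [h4, abs_mul, show |F.side a.1| = 1 by rcases F.side_eq a.1 with ho | ho <;> simp [ho],
      one_mul]
    exact h3

theorem floor_eq_of_near {x : ℝ} {n : ℤ} (h : |x - (n + 1 / 2)| < 1 / 2) :
    ⌊x⌋ = n ∧ Int.fract x ≠ 0 := by
  rw [abs_lt] at h
  have h1 : ⌊x⌋ = n := Int.floor_eq_iff.2 ⟨by linarith, by linarith⟩
  refine ⟨h1, fun h2 => ?_⟩
  have h3 := Int.floor_add_fract x
  rw [h1, h2] at h3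
  linarith

/-- The bound depends only on the height of the copy, not on how far the original was from the cut.
-/
theorem abs_newX_sub_cut_le {k : ℕ} (hk : k ≠ 0) {a : Y × Ray} {n : ℤ}
    (h : |p a.1 - (n + 1 / 2)| < 1 / 2) : |F.newX k a - (n + 1 / 2)| ≤ 1 / (a.2 + k : ℝ) := by
  obtain ⟨h1, h2⟩ := floor_eq_of_near h
  have h3 := one_add_le k a
  have h4 : (0 : ℝ) ≤ k := Nat.cast_nonneg k
  have h5 : (0 : ℝ) < a.2 + k := by linarith
  have h6 : 1 / (8 * (a.2 + k : ℝ)) ≤ 1 / (a.2 + k : ℝ) := by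
    apply one_div_le_one_div_of_le h5
    linarith
  unfold newX
  rw [if_neg h2, h1, add_sub_cancel_left, abs_mul,
    show |F.side a.1| = 1 by rcases F.side_eq a.1 with ho | ho <;> simp [ho], one_mul,
    abs_of_pos (mag_pos h3 (abs_nonneg _))]
  exact (mag_lt_of_ne_zero hk h3 (abs_fract_lt h2)).le.trans h6

theorem fract_newX_eq_zero_iff (k : ℕ) (a : Y × Ray) :
    (Int.fract (F.newX k a) = 0 ↔ Int.fract (p a.1) = 0) ∧ ⌊F.newX k a⌋ = ⌊p a.1⌋ := by
  unfold newX
  by_cases h : Int.fract (p a.1) = 0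
  · rw [if_pos h]
    exact ⟨Iff.rfl, rfl⟩
  · rw [if_neg h]
    have h1 := mag_pos (one_add_le k a) (abs_nonneg (Int.fract (p a.1) - 1 / 2))
    have h2 := mag_lt_half (one_add_le k a) (abs_fract_lt h)
    have h3 : |(⌊p a.1⌋ : ℝ) + 1 / 2 + F.side a.1 * mag k (a.2 + k) |Int.fract (p a.1) - 1 / 2| -
        (⌊p a.1⌋ + 1 / 2)| < 1 / 2 := by
      rw [add_sub_cancel_left, abs_mul,
        show |F.side a.1| = 1 by rcases F.side_eq a.1 with ho | ho <;> simp [ho], one_mul,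
        abs_of_pos h1]
      exact h2
    obtain ⟨h4, h5⟩ := floor_eq_of_near h3
    exact ⟨⟨fun h' => absurd h' h5, fun h' => absurd h' h⟩, h4⟩

/-- From the position one reads off the integer part, then the side as a sign, then the level and
the old distance to the cut by `mag_injective`; `put` restores the rest of the point. Over integers
all levels have the same horizontal coordinate, so only level 0 is allowed. -/
theorem pos_injective {k k' : ℕ} {a a' : Y × Ray} (h : k = 0 ∨ Int.fract (p a.1) ≠ 0)
    (h' : k' = 0 ∨ Int.fract (p a'.1) ≠ 0) (e : F.pos k a = F.pos k' a') : k = k' ∧ a = a' := by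
  have e1 : F.put a.1 (F.newX k a) = F.put a'.1 (F.newX k' a') := congrArg Prod.fst e
  have e2 : (a.2 + k : ℝ) = a'.2 + k' := congrArg (fun b : Y × Ray => (b.2 : ℝ)) e
  have e3 : F.newX k a = F.newX k' a' := by rw [← F.p_pos, ← F.p_pos, e]
  obtain ⟨i1, i2⟩ := F.fract_newX_eq_zero_iff k a
  obtain ⟨j1, j2⟩ := F.fract_newX_eq_zero_iff k' a'
  suffices hs : k = k' ∧ p a.1 = p a'.1 by
    obtain ⟨rfl, hp⟩ := hs
    refine ⟨rfl, Prod.ext ?_ (Subtype.ext (by linarith))⟩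
    rw [← F.put_p a.1, ← F.put_put a.1 (F.newX k a), e1, F.put_put, hp, F.put_p]
  by_cases h0 : Int.fract (p a.1) = 0
  · have h0' := j1.1 (e3 ▸ i1.2 h0)
    have hk := h.resolve_right (not_not.2 h0)
    have hk' := h'.resolve_right (not_not.2 h0')
    refine ⟨hk.trans hk'.symm, ?_⟩
    have := e3
    rw [newX, newX, if_pos h0, if_pos h0'] at this
    exact this
  · have h0' : Int.fract (p a'.1) ≠ 0 := fun h1 => h0 (i1.1 (e3 ▸ j1.2 h1))
    have hf : ⌊p a.1⌋ = ⌊p a'.1⌋ := by rw [← i2, ← j2, e3]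
    have m1 := mag_pos (one_add_le k a) (abs_nonneg (Int.fract (p a.1) - 1 / 2))
    have m2 := mag_pos (one_add_le k' a') (abs_nonneg (Int.fract (p a'.1) - 1 / 2))
    have hx := e3
    rw [newX, newX, if_neg h0, if_neg h0', hf, add_right_inj] at hx
    have hs : F.side a.1 = F.side a'.1 := by
      rcases F.side_eq a.1 with hs | hs <;> rcases F.side_eq a'.1 with hs' | hs' <;>
        rw [hs, hs'] at hx ⊢ <;> linarith
    have hm : mag k (a.2 + k) |Int.fract (p a.1) - 1 / 2| =
        mag k' (a.2 + k) |Int.fract (p a'.1) - 1 / 2| := by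
      rw [hs, ← e2] at hx
      refine mul_left_cancel₀ ?_ hx
      rcases F.side_eq a'.1 with hs' | hs' <;> rw [hs'] <;> norm_num
    obtain ⟨hk, hD⟩ := mag_injective (one_add_le k a) (by rw [e2]; exact one_add_le k' a')
      (abs_nonneg _) (abs_nonneg _) (abs_fract_lt h0) (abs_fract_lt h0') hm
    refine ⟨hk, ?_⟩
    have f1 := F.side_mul_abs a.1
    have f2 := F.side_mul_abs a'.1
    rw [hs, hD, f2] at f1
    have f3 := Int.floor_add_fract (p a.1)
    have f4 := Int.floor_add_fract (p a'.1)
    rw [hf] at f3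
    linarith

theorem isIsometricSMul (F : Frame G p) : IsIsometricSMul G ℝ := by
  refine ⟨fun g => Isometry.of_dist_eq fun x y => ?_⟩
  rw [F.smul_eq, F.smul_eq, Real.dist_eq, Real.dist_eq, add_sub_add_right_eq_sub, ← mul_sub,
    abs_mul, show |F.o g| = 1 by rcases F.o_eq g with ho | ho <;> simp [ho], one_mul]

theorem exists_smul_cut (F : Frame G p) (g : G) (n : ℤ) :
    ∃ m : ℤ, g • (n + 1 / 2 : ℝ) = m + 1 / 2 := by
  rcases F.o_eq g with ho | ho
  · exact ⟨n + F.n g, by rw [F.smul_eq, ho]; push_cast; ring⟩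
  · exact ⟨-n - 1 + F.n g, by rw [F.smul_eq, ho]; push_cast; ring⟩

theorem exists_smul_mem_Icc (F : Frame G p) (x : ℝ) : ∃ g : G, g • x ∈ Set.Icc (0 : ℝ) 1 := by
  obtain ⟨g, hg⟩ := F.translation (-⌊x⌋)
  refine ⟨g, ?_⟩
  rw [hg]
  push_cast
  constructor <;> linarith [Int.floor_le x, Int.lt_floor_add_one x]

theorem cocompact (F : Frame G p) :
    ∃ K : Set Y, IsCompact K ∧ ∀ y, ∃ g : G, ∃ k ∈ K, y = g • k := by
  refine ⟨_, F.proper 0 1, fun y => ?_⟩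
  obtain ⟨g, hg⟩ := F.exists_smul_mem_Icc (p y)
  refine ⟨g⁻¹, g • y, ?_, (inv_smul_smul g y).symm⟩
  rw [Set.mem_preimage, F.p_smul]
  exact hg

end Frame

end Geometry
-- Neighbourhoods of the crossings in the graph of adjacent points
section Neighbourhoods

theorem IsUniform.union {X : Type*} [PseudoMetricSpace X] {Q Q' : X × Ray → X × Ray → Prop}
    (hQ : IsUniform Q) (hQ' : IsUniform Q') : IsUniform fun a b => Q a b ∨ Q' a b := by
  obtain ⟨⟨δ, hδ⟩, h⟩ := hQ
  obtain ⟨⟨δ', hδ'⟩, h'⟩ := hQ'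
  refine ⟨⟨max δ δ', ?_⟩, fun ε hε => ?_⟩
  · rintro a b (hab | hab)
    · exact (hδ a b hab).trans (le_max_left _ _)
    · exact (hδ' a b hab).trans (le_max_right _ _)
  · obtain ⟨T, hT⟩ := h ε hε
    obtain ⟨T', hT'⟩ := h' ε hε
    refine ⟨max T T', ?_⟩
    rintro a b (hab | hab) ha hb
    · exact hT a b hab ((le_max_left _ _).trans_lt ha) ((le_max_left _ _).trans_lt hb)
    · exact hT' a b hab ((le_max_right _ _).trans_lt ha) ((le_max_right _ _).trans_lt hb)

theorem IsUniform.swap {X : Type*} [PseudoMetricSpace X] {Q : X × Ray → X × Ray → Prop}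
    (hQ : IsUniform Q) : IsUniform fun a b => Q b a := by
  obtain ⟨⟨δ, hδ⟩, h⟩ := hQ
  refine ⟨⟨δ, fun a b hab => ?_⟩, fun ε hε => ?_⟩
  · rw [abs_sub_comm]
    exact hδ b a hab
  · obtain ⟨T, hT⟩ := h ε hε
    refine ⟨T, fun a b hab ha hb => ?_⟩
    rw [dist_comm]
    exact hT b a hab hb ha

variable {R : Type u} [Ring R] {G : Type*} [Group G] [MulAction G ℝ] {Y : Type*}
  [TopologicalSpace Y] [MulAction G Y] {p : Y → ℝ}

theorem Obstr.isUniform_entry (F : Frame G p) {A B : Obstr R G p} (φ : A ⟶ B) :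
    IsUniform fun x x' => ∃ a a', Obstr.entry φ a a' ≠ 0 ∧ x = (p a.1, a.2) ∧
      x' = (p a'.1, a'.2) := by
  have := F.isIsometricSMul
  obtain ⟨E, hE, h⟩ := Obstr.Hom.control φ
  refine (hE.isUniform isCompact_Icc F.exists_smul_mem_Icc).mono ?_
  rintro x x' ⟨a, a', ha, rfl, rfl⟩
  exact h a a' ha

theorem Obstr.entry_actFst_ne_zero_iff {A B : Obstr R G p} (φ : A ⟶ B) (g : G) (a b : Y × Ray) :
    Obstr.entry φ (actFst g a) (actFst g b) ≠ 0 ↔ Obstr.entry φ a b ≠ 0 := by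
  rw [Obstr.entry_actFst, not_iff_not]
  constructor
  · intro h
    have h' : eqToHom (A.invariant g a).symm ≫ (eqToHom (A.invariant g a) ≫ Obstr.entry φ a b ≫
        eqToHom (B.invariant g b).symm) ≫ eqToHom (B.invariant g b) = Obstr.entry φ a b := by simp
    rw [← h', h]
    simp
  · intro h
    simp [h]

/-- Two points are adjacent if they are joined by a component of `α` or of its inverse. -/
def Adj {A : Obstr R G p} (α : Aut A) (a a' : Y × Ray) : Prop :=
  (Obstr.entry α.hom a a' ≠ 0 ∨ Obstr.entry α.hom a' a ≠ 0) ∨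
    (Obstr.entry α.inv a a' ≠ 0 ∨ Obstr.entry α.inv a' a ≠ 0)

section

variable {A : Obstr R G p} (α : Aut A)

theorem adj_act (g : G) (a a' : Y × Ray) : Adj α (actFst g a) (actFst g a') ↔ Adj α a a' := by
  unfold Adj
  simp only [Obstr.entry_actFst_ne_zero_iff]

theorem isUniform_adj (F : Frame G p) : IsUniform fun x x' => ∃ a a', Adj α a a' ∧
    x = (p a.1, a.2) ∧ x' = (p a'.1, a'.2) := by
  have h1 := Obstr.isUniform_entry F α.hom
  have h2 := Obstr.isUniform_entry F α.inv
  refine ((h1.union h1.swap).union (h2.union h2.swap)).mono ?_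
  rintro x x' ⟨a, a', (h | h) | (h | h), rfl, rfl⟩
  · exact Or.inl (Or.inl ⟨a, a', h, rfl, rfl⟩)
  · exact Or.inl (Or.inr ⟨a', a, h, rfl, rfl⟩)
  · exact Or.inr (Or.inl ⟨a, a', h, rfl, rfl⟩)
  · exact Or.inr (Or.inr ⟨a', a, h, rfl, rfl⟩)

variable {α} in
theorem Adj.dist_lt {ε : ℝ} (hα : Obstr.IsEpsAut ε α) {a a' : Y × Ray} (h : Adj α a a') :
    |p a.1 - p a'.1| < ε := by
  rw [← Real.dist_eq]
  rcases h with (h | h) | (h | h)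
  · exact hα.1 _ _ h
  · rw [dist_comm]
    exact hα.1 _ _ h
  · exact hα.2 _ _ h
  · rw [dist_comm]
    exact hα.2 _ _ h

/-- The points at distance at most `j`, in the graph of adjacent points, from a point close to
which `α` or its inverse may cross a cut. -/
def cutNbhd : ℕ → Set (Y × Ray)
  | 0 => {a | ∃ a', Adj α a a' ∧ ∃ n : ℤ, |p a.1 - (n + 1 / 2)| ≤ |p a.1 - p a'.1|}
  | j + 1 => cutNbhd j ∪ {a | ∃ a' ∈ cutNbhd j, Adj α a a'}

theorem cutNbhd_mono : Monotone (cutNbhd α) :=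
  monotone_nat_of_le_succ fun _ => Set.subset_union_left

theorem actFst_mem_cutNbhd (F : Frame G p) (g : G) {j : ℕ} {a : Y × Ray} (h : a ∈ cutNbhd α j) :
    actFst g a ∈ cutNbhd α j := by
  have := F.isIsometricSMul
  induction j generalizing a with
  | zero =>
    obtain ⟨a', h, n, hn⟩ := h
    obtain ⟨m, hm⟩ := F.exists_smul_cut g n
    refine ⟨actFst g a', (adj_act α g a a').2 h, m, ?_⟩
    change |p (g • a.1) - _| ≤ |p (g • a.1) - p (g • a'.1)|
    rw [F.p_smul, F.p_smul, ← hm, ← Real.dist_eq, ← Real.dist_eq, dist_smul, dist_smul,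
      Real.dist_eq, Real.dist_eq]
    exact hn
  | succ j ih =>
    rcases h with h | ⟨a', h, h'⟩
    · exact Or.inl (ih h)
    · exact Or.inr ⟨actFst g a', ih h, (adj_act α g a a').2 h'⟩

theorem actFst_mem_cutNbhd_iff (F : Frame G p) (j : ℕ) (g : G) (a : Y × Ray) :
    actFst g a ∈ cutNbhd α j ↔ a ∈ cutNbhd α j := by
  refine ⟨fun h => ?_, actFst_mem_cutNbhd α F g⟩
  have h' := actFst_mem_cutNbhd α F g⁻¹ h
  simpa [actFst] using h'

variable {α} in
theorem exists_cut_of_mem_cutNbhd {ε : ℝ} (hα : Obstr.IsEpsAut ε α) {j : ℕ} {a : Y × Ray}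
    (h : a ∈ cutNbhd α j) : ∃ n : ℤ, |p a.1 - (n + 1 / 2)| < (j + 1) * ε := by
  induction j generalizing a with
  | zero =>
    obtain ⟨a', h, n, hn⟩ := h
    exact ⟨n, by simpa using hn.trans_lt (h.dist_lt hα)⟩
  | succ j ih =>
    rcases h with h | ⟨a', h, h'⟩
    · obtain ⟨n, hn⟩ := ih h
      have hε : 0 < (j + 1 : ℝ) * ε := (abs_nonneg _).trans_lt hn
      have hε' : 0 < ε := pos_of_mul_pos_right hε (by positivity)
      refine ⟨n, hn.trans ?_⟩
      push_cast
      linarith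
    · obtain ⟨n, hn⟩ := ih h
      refine ⟨n, ?_⟩
      have h1 := abs_sub_le (p a.1) (p a'.1) (n + 1 / 2)
      have h2 := h'.dist_lt hα
      push_cast
      linarith

/-- High up, the edges of the graph become arbitrarily short, so finitely many steps from a crossing
end arbitrarily close to a cut. -/
theorem cutNbhd_narrow (F : Frame G p) (j : ℕ) : ∀ ε > (0 : ℝ), ∃ T : ℝ, ∀ a ∈ cutNbhd α j,
    T < (a.2 : ℝ) → ∃ n : ℤ, |p a.1 - (n + 1 / 2)| < ε := by
  obtain ⟨⟨δ, hδ⟩, hsmall⟩ := isUniform_adj α F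
  have hδ' : ∀ {a a'}, Adj α a a' → |(a.2 : ℝ) - a'.2| ≤ δ := fun {a a'} h =>
    hδ (p a.1, a.2) (p a'.1, a'.2) ⟨a, a', h, rfl, rfl⟩
  have hsmall' : ∀ ε > (0 : ℝ), ∃ T : ℝ, ∀ a a', Adj α a a' → T < (a.2 : ℝ) →
      |p a.1 - p a'.1| < ε := by
    intro ε hε
    obtain ⟨T, hT⟩ := hsmall ε hε
    -- Uniform control needs both ends to be high; the bound δ on height differences gives this from
    -- one end.
    refine ⟨T + |δ|, fun a a' h ha => ?_⟩
    have h1 := abs_le.1 (hδ' h)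
    have h2 := le_abs_self δ
    have h3 := abs_nonneg δ
    rw [← Real.dist_eq]
    refine hT (p a.1, a.2) (p a'.1, a'.2) ⟨a, a', h, rfl, rfl⟩ ?_ ?_
    · change T < (a.2 : ℝ)
      linarith
    · change T < (a'.2 : ℝ)
      linarith
  induction j with
  | zero =>
    intro ε hε
    obtain ⟨T, hT⟩ := hsmall' ε hε
    refine ⟨T, ?_⟩
    rintro a ⟨a', h, n, hn⟩ ha
    exact ⟨n, hn.trans_lt (hT a a' h ha)⟩
  | succ j ih =>
    intro ε hε
    obtain ⟨T, hT⟩ := ih (ε / 2) (by positivity)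
    obtain ⟨T', hT'⟩ := hsmall' (ε / 2) (by positivity)
    refine ⟨max T T' + |δ|, ?_⟩
    have h3 := abs_nonneg δ
    have h4 := le_max_left T T'
    have h5 := le_max_right T T'
    rintro a (h | ⟨a', h, h'⟩) ha
    · obtain ⟨n, hn⟩ := hT a h (by linarith)
      exact ⟨n, by linarith⟩
    · have h1 := abs_le.1 (hδ' h')
      have h2 := le_abs_self δ
      obtain ⟨n, hn⟩ := hT a' h (by linarith)
      refine ⟨n, ?_⟩
      have h6 := hT' a a' h' (by linarith)
      have h7 := abs_sub_le (p a.1) (p a'.1) (n + 1 / 2)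
      linarith

end

/-- An invariant set of points within distance less than `14 / 30` of the cuts whose distance from
the cuts tends to zero with the height. -/
structure IsNarrow (G : Type*) [Group G] {Y : Type*} [MulAction G Y] (p : Y → ℝ)
    (χ : Set (Y × Ray)) : Prop where
  act : ∀ (g : G) a, actFst g a ∈ χ ↔ a ∈ χ
  near : ∀ a ∈ χ, ∃ n : ℤ, |p a.1 - (n + 1 / 2)| < 14 / 30
  narrow : ∀ ε > (0 : ℝ), ∃ T : ℝ, ∀ a ∈ χ, T < (a.2 : ℝ) → ∃ n : ℤ, |p a.1 - (n + 1 / 2)| < ε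

/-- A crossing edge and at most `j ≤ 13` further edges, each shorter than 1/30, stay within 14/30 of
a cut. -/
theorem isNarrow_cutNbhd (F : Frame G p) {A : Obstr R G p} {α : Aut A}
    (hα : Obstr.IsEpsAut (1 / 30) α) {j : ℕ} (hj : j ≤ 13) : IsNarrow G p (cutNbhd α j) where
  act := actFst_mem_cutNbhd_iff α F j
  near a ha := by
    obtain ⟨n, hn⟩ := exists_cut_of_mem_cutNbhd hα ha
    refine ⟨n, ?_⟩
    have hj' : (j : ℝ) ≤ 13 := by exact_mod_cast hj
    linarith
  narrow := cutNbhd_narrow α F j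

theorem cut_unique {x x' : ℝ} {n n' : ℤ} (h : |x - (n + 1 / 2)| + |x - x'| +
    |x' - (n' + 1 / 2)| < 1) : n = n' := by
  have h1 := abs_le.1 (le_refl |x - (n + 1 / 2)|)
  have h2 := abs_le.1 (le_refl |x - x'|)
  have h3 := abs_le.1 (le_refl |x' - (n' + 1 / 2)|)
  have h4 : (n : ℝ) < n' + 1 := by linarith
  have h5 : (n' : ℝ) < n + 1 := by linarith
  have h6 : n < n' + 1 := by exact_mod_cast h4
  have h7 : n' < n + 1 := by exact_mod_cast h5
  omega

/-- The threshold concerns the height of the copy and is the same for all levels. Positive levels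
were pushed to the cut; level 0 moves little, and narrowness of `χ` places the original near the
cut. -/
theorem IsNarrow.exists_newX_near {χ : Set (Y × Ray)} (F : Frame G p) (hχ : IsNarrow G p χ)
    (ε : ℝ) (hε : 0 < ε) : ∃ T : ℝ, ∀ a ∈ χ, ∀ k : ℕ, T < (a.2 + k : ℝ) → ∀ n : ℤ,
      |p a.1 - (n + 1 / 2)| < 14 / 30 → |F.newX k a - (n + 1 / 2)| < ε := by
  -- The bound 1/2 identifies the cut supplied here with the given one, since 14/30 + 1/2 < 1.
  obtain ⟨T, hT⟩ := hχ.narrow (min (ε / 2) (1 / 2)) (by positivity)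
  refine ⟨max T (2 / ε), fun a ha k hk n hn => ?_⟩
  have h1 := (le_max_left _ _).trans_lt hk
  have h2 := (le_max_right _ _).trans_lt hk
  have h0 : 0 < (a.2 + k : ℝ) := (show 0 < 2 / ε by positivity).trans h2
  have h3 : 1 / (a.2 + k : ℝ) < ε / 2 := by
    rw [div_lt_iff₀ hε] at h2
    rw [div_lt_iff₀ h0]
    linarith
  by_cases hk0 : k = 0
  · subst hk0
    rw [Nat.cast_zero, add_zero] at h1 h3
    obtain ⟨m, hm⟩ := hT a ha h1
    have h4 := hm.trans_le (min_le_left _ _)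
    have h5 := hm.trans_le (min_le_right _ _)
    have h6 : n = m := cut_unique (x := p a.1) (x' := p a.1) (by
      rw [sub_self, abs_zero]
      linarith)
    subst h6
    have h7 := F.abs_newX_zero_sub_le a
    have h8 := abs_sub_le (F.newX 0 a) (p a.1) (n + 1 / 2)
    linarith
  · have h4 := F.abs_newX_sub_cut_le hk0 (show |p a.1 - (n + 1 / 2)| < 1 / 2 by linarith)
    linarith

end Neighbourhoods
-- The object of copies
section Copies

theorem finite_inter_of_locallyFinite {Z : Type*} [TopologicalSpace Z] {S K : Set Z}
    (hS : ∀ a, ∃ U : Set Z, IsOpen U ∧ a ∈ U ∧ (U ∩ S).Finite) (hK : IsCompact K) :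
    (K ∩ S).Finite := by
  choose U hU haU hfin using hS
  obtain ⟨t, -, ht⟩ := hK.elim_nhds_subcover U fun a _ => (hU a).mem_nhds (haU a)
  refine (t.finite_toSet.biUnion fun a _ => hfin a).subset ?_
  rintro b ⟨hb, hb'⟩
  obtain ⟨a, ha, hba⟩ := Set.mem_iUnion₂.1 (ht hb)
  exact Set.mem_biUnion ha ⟨hba, hb'⟩

theorem isCompact_ray_le (T : ℝ) : IsCompact {t : Ray | (t : ℝ) ≤ T} := by
  have h : IsCompact ((Subtype.val : Ray → ℝ) ⁻¹' Set.Icc 1 T) :=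
    isClosed_Ici.isClosedEmbedding_subtypeVal.isCompact_preimage isCompact_Icc
  exact h.of_isClosed_subset (isClosed_le continuous_subtype_val continuous_const)
    fun t ht => ⟨t.2, ht⟩

variable {R : Type u} [Ring R] {G : Type*} [Group G] [MulAction G ℝ] {Y : Type*}
  [TopologicalSpace Y] [MulAction G Y] {p : Y → ℝ} (F : Frame G p) (χ : Set (Y × Ray))

/-- The positions of the copies of level in `P`: the copies of level `0` of all points and the
copies of higher level of the points of `χ`. -/
def levelSet (P : Set ℕ) : Set (Y × Ray) :=
  {b | ∃ k a, k ∈ P ∧ (k = 0 ∨ a ∈ χ) ∧ F.pos k a = b}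

open Classical in
/-- The point of which a given point is a copy. -/
noncomputable def orig (b : Y × Ray) : Y × Ray :=
  if h : ∃ k a, (k = 0 ∨ a ∈ χ) ∧ F.pos k a = b then h.choose_spec.choose else b

variable {χ}

theorem IsNarrow.fract_ne (hχ : IsNarrow G p χ) {a : Y × Ray} (ha : a ∈ χ) :
    Int.fract (p a.1) ≠ 0 := by
  obtain ⟨n, hn⟩ := hχ.near a ha
  exact (Frame.floor_eq_of_near (hn.trans (by norm_num))).2

section

variable (hχ : IsNarrow G p χ)

include hχ

theorem pos_inj {k k' : ℕ} {a a' : Y × Ray} (h : k = 0 ∨ a ∈ χ) (h' : k' = 0 ∨ a' ∈ χ)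
    (e : F.pos k a = F.pos k' a') : k = k' ∧ a = a' :=
  F.pos_injective (h.imp_right hχ.fract_ne) (h'.imp_right hχ.fract_ne) e

theorem orig_pos {k : ℕ} {a : Y × Ray} (h : k = 0 ∨ a ∈ χ) : orig F χ (F.pos k a) = a := by
  have h' : ∃ k' a', (k' = 0 ∨ a' ∈ χ) ∧ F.pos k' a' = F.pos k a := ⟨k, a, h, rfl⟩
  rw [orig, dif_pos h']
  have h2 := h'.choose_spec.choose_spec
  exact (pos_inj F hχ h2.1 h h2.2).2

theorem pos_mem_levelSet_iff {k : ℕ} {a : Y × Ray} (h : k = 0 ∨ a ∈ χ) (P : Set ℕ) :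
    F.pos k a ∈ levelSet F χ P ↔ k ∈ P := by
  refine ⟨?_, fun hk => ⟨k, a, hk, h, rfl⟩⟩
  rintro ⟨k', a', hk', h', e⟩
  exact (pos_inj F hχ h' h e).1 ▸ hk'

theorem valid_act (g : G) {k : ℕ} {a : Y × Ray} (h : k = 0 ∨ a ∈ χ) :
    k = 0 ∨ actFst g a ∈ χ := h.imp_right (hχ.act g a).2

theorem actFst_mem_levelSet (P : Set ℕ) (g : G) {b : Y × Ray} (hb : b ∈ levelSet F χ P) :
    actFst g b ∈ levelSet F χ P := by
  obtain ⟨k, a, hk, h, rfl⟩ := hb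
  exact ⟨k, actFst g a, hk, valid_act hχ g h, F.pos_act k g a⟩

theorem actFst_mem_levelSet_iff (P : Set ℕ) (g : G) (b : Y × Ray) :
    actFst g b ∈ levelSet F χ P ↔ b ∈ levelSet F χ P := by
  refine ⟨fun h => ?_, actFst_mem_levelSet F hχ P g⟩
  have h' := actFst_mem_levelSet F hχ P g⁻¹ h
  simpa [actFst] using h'

theorem orig_act (g : G) (b : Y × Ray) : orig F χ (actFst g b) = actFst g (orig F χ b) := by
  by_cases hb : b ∈ levelSet F χ Set.univ
  · obtain ⟨k, a, hk, h, rfl⟩ := hb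
    rw [← F.pos_act, orig_pos F hχ h, orig_pos F hχ (valid_act hχ g h)]
  -- Away from the copies the default value of `orig` is the point itself, which is equivariant as
  -- well.
  · have h1 : ∀ b, b ∉ levelSet F χ Set.univ → orig F χ b = b := fun b hb =>
      dif_neg fun ⟨k, a, h, e⟩ => hb ⟨k, a, trivial, h, e⟩
    rw [h1 b hb, h1 _ (mt (actFst_mem_levelSet_iff F hχ _ g b).1 hb)]

/-- Raising level `k` by `k` leaves only finitely many levels below a given height, and each of them
contributes finitely many points over a compact set. -/
theorem levelSet_finite (A : Obstr R G p) (P : Set ℕ) (b₀ : Y × Ray) :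
    ∃ U : Set (Y × Ray), IsOpen U ∧ b₀ ∈ U ∧
      (U ∩ {b | b ∈ levelSet F χ P ∧ Nontrivial (A.mod (orig F χ b))}).Finite := by
  -- Copies move horizontally by at most 1 and never downwards, so originals of copies in the
  -- neighbourhood of radius 1 lie in this larger box.
  let K : Set (Y × Ray) := (p ⁻¹' Set.Icc (p b₀.1 - 2) (p b₀.1 + 2)) ×ˢ
    {t : Ray | (t : ℝ) ≤ b₀.2 + 1}
  have hK : IsCompact K := (F.proper _ _).prod (isCompact_ray_le _)
  have hfin := finite_inter_of_locallyFinite A.locallyFinite hK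
  refine ⟨{b | |p b.1 - p b₀.1| < 1 ∧ (b.2 : ℝ) < b₀.2 + 1}, ?_, by simp, ?_⟩
  · have h := F.continuous_p
    refine IsOpen.inter ?_ ?_
    · exact isOpen_lt (f := fun b : Y × Ray => |p b.1 - p b₀.1|) (by fun_prop) continuous_const
    · exact isOpen_lt (f := fun b : Y × Ray => (b.2 : ℝ)) (by fun_prop) continuous_const
  · refine (((Set.finite_Iic ⌊(b₀.2 : ℝ) + 1⌋₊).prod hfin).image
      (fun i => F.pos i.1 i.2)).subset ?_
    rintro b ⟨⟨hb1, hb2⟩, ⟨k, a, -, h, rfl⟩, hb3⟩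
    rw [orig_pos F hχ h] at hb3
    rw [F.p_pos] at hb1
    rw [F.pos_snd] at hb2
    have h1 : (1 : ℝ) ≤ a.2 := a.2.2
    have h2 : (0 : ℝ) ≤ k := Nat.cast_nonneg k
    have h3 := abs_le.1 (F.abs_newX_sub_le_one k a)
    have h4 := abs_lt.1 hb1
    refine ⟨(k, a), ⟨Nat.le_floor (by linarith), ⟨⟨by linarith, by linarith⟩, ?_⟩, hb3⟩, rfl⟩
    change (a.2 : ℝ) ≤ _
    linarith

end

/-- The object consisting of the copies of `A` of level in `P`. -/
noncomputable def copies (hχ : IsNarrow G p χ) (A : Obstr R G p) (P : Set ℕ) : Obstr R G p :=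
  A.pull (orig F χ) (levelSet F χ P) (orig_act F hχ) (actFst_mem_levelSet_iff F hχ P)
    (levelSet_finite F hχ A P) F.cocompact

/-- The tautological chart of the object of copies. -/
noncomputable def copiesChart (hχ : IsNarrow G p χ) (A : Obstr R G p) (P : Set ℕ) :
    Chart A (copies F hχ A P) :=
  Chart.pull A (orig F χ) (levelSet F χ P) (orig_act F hχ) (actFst_mem_levelSet_iff F hχ P)
    (levelSet_finite F hχ A P) F.cocompact

end Copies
-- Inclusions, projections and level shifts
section CopyMorphisms

open Obstr

variable {R : Type u} [Ring R] {G : Type*} [Group G] [MulAction G ℝ] [IsIsometricSMul G ℝ]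
  {Y : Type*} [TopologicalSpace Y] [MulAction G Y] {p : Y → ℝ} (F : Frame G p)
  {χ : Set (Y × Ray)} (hχ : IsNarrow G p χ) (A : Obstr R G p)

theorem actFst_inj {Z T : Type*} [MulAction G Z] (g : G) {a b : Z × T} :
    actFst g a = actFst g b ↔ a = b := by
  simp [actFst, Prod.ext_iff]

theorem isUniform_eq {X : Type*} [PseudoMetricSpace X] :
    IsUniform fun x x' : X × Ray => x = x' := by
  refine ⟨⟨0, ?_⟩, fun ε hε => ⟨0, ?_⟩⟩
  · rintro a b rfl
    simp
  · rintro a b rfl - -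
    simpa using hε

/-- The identification of the module of a copy with the module of the original. -/
noncomputable def copyDown (P : Set ℕ) (b : Y × Ray) :
    (copies F hχ A P).mod b ⟶ A.mod (orig F χ b) := (copiesChart F hχ A P).down b

/-- The identification of the module of the original with the module of a copy. -/
noncomputable def copyUp (P : Set ℕ) (b : Y × Ray) :
    A.mod (orig F χ b) ⟶ (copies F hχ A P).mod b := (copiesChart F hχ A P).up b

theorem copyDown_copyUp (P : Set ℕ) (b : Y × Ray) :
    copyDown F hχ A P b ≫ copyUp F hχ A P b = 𝟙 _ := (copiesChart F hχ A P).down_up b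

theorem copyUp_copyDown {P : Set ℕ} {b : Y × Ray} (hb : b ∈ levelSet F χ P) {Z : ModuleCat R}
    (z : A.mod (orig F χ b) ⟶ Z) : copyUp F hχ A P b ≫ copyDown F hχ A P b ≫ z = z := by
  have h : copyUp F hχ A P b ≫ copyDown F hχ A P b = 𝟙 _ := (copiesChart F hχ A P).up_down b hb
  rw [← Category.assoc, h, Category.id_comp]

theorem copyDown_eq_zero {P : Set ℕ} {b : Y × Ray} (hb : b ∉ levelSet F χ P) :
    copyDown F hχ A P b = 0 := (copiesChart F hχ A P).down_eq_zero b hb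

theorem copyUp_eq_zero {P : Set ℕ} {b : Y × Ray} (hb : b ∉ levelSet F χ P) :
    copyUp F hχ A P b = 0 := (copiesChart F hχ A P).up_eq_zero hb

/-- The matrix which is the identity over the common points of two objects of copies. -/
noncomputable def incl (P P' : Set ℕ) : copies F hχ A P ⟶ copies F hχ A P' :=
  Chart.hom (copiesChart F hχ A P) (copiesChart F hχ A P') (𝟙 A) (fun b b' => b = b')
    (fun g _ _ => actFst_inj g)
    (fun b' _ => (Set.finite_singleton b').subset fun _ h => h.1)
    (fun b _ => (Set.finite_singleton b).subset fun _ h => h.1.symm)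
    (isUniform_eq.mono (by
      rintro x x' ⟨b, b', rfl, -, -, -, rfl, rfl⟩
      rfl))

theorem entry_incl_self (P P' : Set ℕ) (b : Y × Ray) :
    entry (incl F hχ A P P') b b =
      copyDown F hχ A P b ≫ copyUp F hχ A P' b := by
  refine (if_pos rfl).trans ?_
  change copyDown F hχ A P b ≫ entry (𝟙 A) (orig F χ b) (orig F χ b) ≫ copyUp F hχ A P' b = _
  rw [entry_one_self, Category.id_comp]

theorem entry_incl_of_ne (P P' : Set ℕ) {b b' : Y × Ray} (h : b ≠ b') :
    entry (incl F hχ A P P') b b' = 0 := if_neg h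

include hχ in
theorem levelSet_inter_subset {P P' P'' : Set ℕ} (h : P ∩ P'' ⊆ P') :
    levelSet F χ P ∩ levelSet F χ P'' ⊆ levelSet F χ P' := by
  rintro _ ⟨⟨k, a, hk, ha, rfl⟩, h'⟩
  exact ⟨k, a, h ⟨hk, (pos_mem_levelSet_iff F hχ ha P'').1 h'⟩, ha, rfl⟩

/-- Passing through `P'` loses nothing as long as `P'` contains the levels common to both ends. -/
theorem incl_comp {P P' P'' : Set ℕ} (h : P ∩ P'' ⊆ P') :
    incl F hχ A P P' ≫ incl F hχ A P' P'' = incl F hχ A P P'' := by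
  refine hom_ext fun b b'' => ?_
  rw [entry_comp_of_left (b := b) _ _ fun b' hb' => entry_incl_of_ne F hχ A P P' hb'.symm]
  by_cases hb : b = b''
  · subst hb
    rw [entry_incl_self, entry_incl_self, entry_incl_self]
    by_cases hb' : b ∈ levelSet F χ P'
    · rw [Category.assoc, copyUp_copyDown F hχ A hb']
    · rw [copyUp_eq_zero F hχ A hb', Limits.comp_zero, Limits.zero_comp]
      by_cases hb1 : b ∈ levelSet F χ P
      · have hb2 : b ∉ levelSet F χ P'' := fun hb2 =>
          hb' (levelSet_inter_subset F hχ h ⟨hb1, hb2⟩)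
        rw [copyUp_eq_zero F hχ A hb2, Limits.comp_zero]
      · rw [copyDown_eq_zero F hχ A hb1, Limits.zero_comp]
  · rw [entry_incl_of_ne F hχ A _ _ hb, entry_incl_of_ne F hχ A _ _ hb, Limits.comp_zero]

theorem incl_self (P : Set ℕ) : incl F hχ A P P = 𝟙 _ := by
  refine hom_ext fun b b' => ?_
  by_cases hb : b = b'
  · subst hb
    rw [entry_incl_self, entry_one_self, copyDown_copyUp]
  · rw [entry_incl_of_ne F hχ A _ _ hb, entry_one_of_ne _ hb]

/-- The projection to the copies of level in `P`. -/
noncomputable def proj (P : Set ℕ) :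
    copies F hχ A Set.univ ⟶ copies F hχ A Set.univ :=
  incl F hχ A Set.univ P ≫ incl F hχ A P Set.univ

theorem entry_proj_of_mem {P : Set ℕ} {b : Y × Ray} (h : b ∈ levelSet F χ P) :
    entry (proj F hχ A P) b b = 𝟙 _ := by
  rw [proj, entry_comp_of_left (b := b) _ _ fun b' hb' => entry_incl_of_ne F hχ A _ _ hb'.symm,
    entry_incl_self, entry_incl_self, Category.assoc, copyUp_copyDown F hχ A h, copyDown_copyUp]

theorem entry_proj_of_notMem {P : Set ℕ} {b : Y × Ray} (h : b ∉ levelSet F χ P)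
    (b' : Y × Ray) : entry (proj F hχ A P) b b' = 0 := by
  rw [proj, entry_comp_of_left (b := b) _ _ fun b' hb' => entry_incl_of_ne F hχ A _ _ hb'.symm,
    entry_incl_self, copyUp_eq_zero F hχ A h, Limits.comp_zero, Limits.zero_comp]

theorem entry_proj_of_ne {P : Set ℕ} {b b' : Y × Ray} (h : b ≠ b') :
    entry (proj F hχ A P) b b' = 0 := by
  rw [proj, entry_comp_of_left (b := b) _ _ fun b' hb' => entry_incl_of_ne F hχ A _ _ hb'.symm,
    entry_incl_of_ne F hχ A _ _ h, Limits.comp_zero]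

theorem proj_add_proj {P P' : Set ℕ} (h : IsCompl P P') :
    proj F hχ A P + proj F hχ A P' = 𝟙 _ := by
  refine hom_ext fun b b' => ?_
  by_cases hb : b = b'
  · subst hb
    rw [entry_add, entry_one_self]
    by_cases hu : b ∈ levelSet F χ Set.univ
    · obtain ⟨k, a, -, ha, rfl⟩ := hu
      by_cases hk : k ∈ P
      · have hk' : k ∉ P' := fun hk' => (Set.disjoint_left.1 h.disjoint) hk hk'
        rw [entry_proj_of_mem F hχ A ((pos_mem_levelSet_iff F hχ ha P).2 hk),
          entry_proj_of_notMem F hχ A (mt (pos_mem_levelSet_iff F hχ ha P').1 hk'), add_zero]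
      · have hk' : k ∈ P' := 
          (show k ∈ P ∪ P' from by
            have h' : P ∪ P' = Set.univ := h.sup_eq_top
            exact h' ▸ Set.mem_univ k).resolve_left hk
        rw [entry_proj_of_mem F hχ A ((pos_mem_levelSet_iff F hχ ha P').2 hk'),
          entry_proj_of_notMem F hχ A (mt (pos_mem_levelSet_iff F hχ ha P).1 hk), zero_add]
    · have hP : ∀ P, b ∉ levelSet F χ P := by
        rintro P ⟨k, a, -, ha, rfl⟩
        exact hu ⟨k, a, trivial, ha, rfl⟩
      rw [entry_proj_of_notMem F hχ A (hP P), entry_proj_of_notMem F hχ A (hP P'), add_zero,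
        ← copyDown_copyUp, copyDown_eq_zero F hχ A hu, Limits.zero_comp]
  · rw [entry_add, entry_proj_of_ne F hχ A hb, entry_proj_of_ne F hχ A hb,
      entry_one_of_ne _ hb, add_zero]

/-- The decomposition of the object of copies into copies of complementary sets of levels. -/
@[simps]
noncomputable def levelDecomp {P P' : Set ℕ} (h : IsCompl P P') :
    Decomp (copies F hχ A P') (copies F hχ A Set.univ) (copies F hχ A P) where
  f := incl F hχ A P' Set.univ
  r := incl F hχ A Set.univ P'
  g := incl F hχ A Set.univ P
  s := incl F hχ A P Set.univ
  f_r := by rw [incl_comp F hχ A (Set.subset_univ _), incl_self]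
  s_g := by rw [incl_comp F hχ A (Set.subset_univ _), incl_self]
  total := proj_add_proj F hχ A h.symm

variable (χ) in
/-- The conditions on a set `Q` of points for the embedding of the part of an object over `Q` as
copies of level `k`. -/
structure IsEmbeddable (k : ℕ) (Q : Set (Y × Ray)) : Prop where
  valid : ∀ a ∈ Q, k = 0 ∨ a ∈ χ
  act : ∀ (g : G) a, actFst g a ∈ Q ↔ a ∈ Q
  control : IsUniform fun x x' => ∃ a ∈ Q, x = (p a.1, a.2) ∧
    x' = (p (F.pos k a).1, (F.pos k a).2)

theorem isEmbeddable_zero : IsEmbeddable F χ 0 Set.univ := by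
  refine ⟨fun _ _ => Or.inl rfl, fun _ _ => Iff.rfl, ⟨0, ?_⟩, fun ε hε => ⟨1 / ε, ?_⟩⟩
  · rintro x x' ⟨a, -, rfl, rfl⟩
    simp [F.pos_snd]
  · rintro x x' ⟨a, -, rfl, rfl⟩ h -
    have h' : 1 / ε < (a.2 : ℝ) := h
    have h0 : 0 < (a.2 : ℝ) := (show 0 < 1 / ε by positivity).trans h'
    change dist (p a.1) (p (F.pos 0 a).1) < ε
    rw [F.p_pos, dist_comm, Real.dist_eq]
    refine (F.abs_newX_zero_sub_le a).trans_lt ?_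
    rw [div_lt_iff₀ hε] at h'
    rw [div_lt_iff₀ h0]
    linarith

include hχ in
-- The height bound is `k` itself. Its growth with `k` is harmless, as each embedding involves a
-- single level and serves only to test matrices level by level.
theorem isEmbeddable_of_isNarrow (k : ℕ) : IsEmbeddable F χ k χ := by
  refine ⟨fun _ h => Or.inr h, hχ.act, ⟨k, ?_⟩, fun ε hε => ?_⟩
  · rintro x x' ⟨a, -, rfl, rfl⟩
    change |(a.2 : ℝ) - (F.pos k a).2| ≤ k
    rw [F.pos_snd, sub_add_cancel_left, abs_neg, Nat.abs_cast]
  · obtain ⟨T, hT⟩ := hχ.exists_newX_near F (ε / 2) (by positivity)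
    obtain ⟨T', hT'⟩ := hχ.narrow (min (ε / 2) (14 / 30)) (by positivity)
    refine ⟨max T T', ?_⟩
    rintro x x' ⟨a, ha, rfl, rfl⟩ h1 h2
    obtain ⟨n, hn⟩ := hT' a ha ((le_max_right _ _).trans_lt h1)
    have h3 := hn.trans_le (min_le_left _ _)
    have h4 := hT a ha k ((le_max_left _ _).trans_lt h2) n (hn.trans_le (min_le_right _ _))
    change dist (p a.1) (p (F.pos k a).1) < ε
    rw [F.p_pos, Real.dist_eq]
    rw [abs_sub_comm] at h4
    have h5 := abs_sub_le (p a.1) (n + 1 / 2) (F.newX k a)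
    linarith

variable {A} in
/-- The embedding of the part over `Q` as copies of level `k`. -/
noncomputable def embed {k : ℕ} {Q : Set (Y × Ray)} (hQ : IsEmbeddable F χ k Q) :
    A ⟶ copies F hχ A Set.univ :=
  Chart.hom (Chart.refl A) (copiesChart F hχ A Set.univ) (𝟙 A)
    (fun a b => a ∈ Q ∧ F.pos k a = b)
    (fun g a b => by rw [hQ.act, F.pos_act, actFst_inj])
    (fun _ a => (Set.finite_singleton a).subset fun _ h => h.2.2)
    (fun a _ => (Set.finite_singleton (F.pos k a)).subset fun _ h => h.1.2.symm)
    (hQ.control.mono (by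
      rintro x x' ⟨a, b, ⟨ha, rfl⟩, -, -, -, rfl, rfl⟩
      exact ⟨a, ha, rfl, rfl⟩))

variable {A}

theorem entry_embed_of_not {k : ℕ} {Q : Set (Y × Ray)} (hQ : IsEmbeddable F χ k Q)
    {a b : Y × Ray} (h : ¬ (a ∈ Q ∧ F.pos k a = b)) :
    entry (embed F hχ hQ : A ⟶ _) a b = 0 := if_neg h

theorem entry_embed {k : ℕ} {Q : Set (Y × Ray)} (hQ : IsEmbeddable F χ k Q)
    {a b : Y × Ray} (h : a ∈ Q ∧ F.pos k a = b) :
    entry (embed F hχ hQ : A ⟶ _) a b =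
      entry (𝟙 A) a (orig F χ b) ≫ copyUp F hχ A Set.univ b :=
  (if_pos h).trans (Category.id_comp _)

theorem entry_embed_comp {k : ℕ} {Q : Set (Y × Ray)} (hQ : IsEmbeddable F χ k Q)
    {B : Obstr R G p} (ψ : copies F hχ A Set.univ ⟶ B) {a c : Y × Ray} :
    entry (embed F hχ hQ ≫ ψ) a c =
      entry (embed F hχ hQ) a (F.pos k a) ≫ entry ψ (F.pos k a) c :=
  entry_comp_of_left _ _ fun _ hb => entry_embed_of_not F hχ hQ fun h => hb h.2.symm

theorem embed_proj_of_mem {k : ℕ} {Q : Set (Y × Ray)} (hQ : IsEmbeddable F χ k Q) {P : Set ℕ}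
    (hk : k ∈ P) : (embed F hχ hQ : A ⟶ _) ≫ proj F hχ A P = embed F hχ hQ := by
  refine hom_ext fun a b => ?_
  rw [entry_embed_comp]
  by_cases ha : a ∈ Q
  · have h := (pos_mem_levelSet_iff F hχ (hQ.valid a ha) P).2 hk
    by_cases hb : F.pos k a = b
    · subst hb
      rw [entry_proj_of_mem F hχ A h, Category.comp_id]
    · rw [entry_proj_of_ne F hχ A hb, Limits.comp_zero,
        entry_embed_of_not F hχ hQ fun h => hb h.2]
  · rw [entry_embed_of_not F hχ hQ fun h => ha h.1, entry_embed_of_not F hχ hQ fun h => ha h.1,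
      Limits.zero_comp]

theorem embed_proj_of_notMem {k : ℕ} {Q : Set (Y × Ray)} (hQ : IsEmbeddable F χ k Q) {P : Set ℕ}
    (hk : k ∉ P) : (embed F hχ hQ : A ⟶ _) ≫ proj F hχ A P = 0 := by
  refine hom_ext fun a b => ?_
  rw [entry_embed_comp, entry_zero]
  by_cases ha : a ∈ Q
  · have h := mt (pos_mem_levelSet_iff F hχ (hQ.valid a ha) P).1 hk
    rw [entry_proj_of_notMem F hχ A h, Limits.comp_zero]
  · rw [entry_embed_of_not F hχ hQ fun h => ha h.1, Limits.zero_comp]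

variable (A) in
/-- The identification of the copies of level `0` with the original. -/
noncomputable def retract : copies F hχ A Set.univ ⟶ A :=
  Chart.hom (copiesChart F hχ A Set.univ) (Chart.refl A) (𝟙 A) (fun b a => F.pos 0 a = b)
    (fun g b a => by rw [F.pos_act, actFst_inj])
    (fun a _ => (Set.finite_singleton (F.pos 0 a)).subset fun _ h => h.1.symm)
    (fun _ a => (Set.finite_singleton a).subset fun _ h => h.2.2)
    ((isEmbeddable_zero F (χ := χ)).control.swap.mono (by
      rintro x x' ⟨b, a, rfl, -, -, -, rfl, rfl⟩
      exact ⟨a, trivial, rfl, rfl⟩))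

theorem entry_retract_of_ne {a b : Y × Ray} (h : F.pos 0 a ≠ b) :
    entry (retract F hχ A) b a = 0 := if_neg h

theorem entry_retract {a b : Y × Ray} (h : F.pos 0 a = b) :
    entry (retract F hχ A) b a =
      copyDown F hχ A Set.univ b ≫ entry (𝟙 A) (orig F χ b) a :=
  (if_pos h).trans (congrArg (copyDown F hχ A Set.univ b ≫ ·) (Category.comp_id _))

/-- Entries of the identity matrix serve as transport between modules at points that are equal only
propositionally, such as `a` and `orig F χ (F.pos k a)`. -/
theorem entry_one_comp_entry_one (A : Obstr R G p) {a c d : Y × Ray} (h : c = a) :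
    entry (𝟙 A) a c ≫ entry (𝟙 A) c d = entry (𝟙 A) a d := by
  subst h
  rw [entry_one_self, Category.id_comp]

theorem embed_retract :
    embed F hχ (isEmbeddable_zero F) ≫ retract F hχ A = 𝟙 A := by
  refine hom_ext fun a a' => ?_
  rw [entry_embed_comp, entry_embed F hχ (isEmbeddable_zero F) ⟨Set.mem_univ _, rfl⟩]
  by_cases h : a = a'
  · subst h
    have h2 : orig F χ (F.pos 0 a) = a := orig_pos F hχ (Or.inl rfl)
    rw [entry_retract F hχ rfl, Category.assoc,
      copyUp_copyDown F hχ A ⟨0, a, Set.mem_univ _, Or.inl rfl, rfl⟩, entry_one_comp_entry_one A h2]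
  · rw [entry_retract_of_ne F hχ fun h' => h (pos_inj F hχ (Or.inl rfl) (Or.inl rfl) h').2.symm,
      Limits.comp_zero, entry_one_of_ne A h]

theorem retract_embed :
    retract F hχ A ≫ embed F hχ (isEmbeddable_zero F) = proj F hχ A {0} := by
  refine hom_ext fun b b' => ?_
  by_cases hb : b ∈ levelSet F χ {0}
  · obtain ⟨k, a, rfl, -, rfl⟩ := hb
    have h2 : orig F χ (F.pos 0 a) = a := orig_pos F hχ (Or.inl rfl)
    rw [entry_comp_of_left (b := a) _ _ fun a' ha' => entry_retract_of_ne F hχ fun h' =>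
      ha' (pos_inj F hχ (Or.inl rfl) (Or.inl rfl) h').2, entry_retract F hχ rfl]
    by_cases h : F.pos 0 a = b'
    · subst h
      rw [entry_embed F hχ (isEmbeddable_zero F) ⟨Set.mem_univ _, rfl⟩, Category.assoc,
        ← Category.assoc (entry _ _ _), entry_one_comp_entry_one A h2.symm, entry_one_self,
        Category.id_comp, copyDown_copyUp,
        entry_proj_of_mem F hχ A ⟨0, a, Set.mem_singleton 0, Or.inl rfl, rfl⟩]
    · rw [entry_embed_of_not F hχ _ fun h' => h h'.2, Limits.comp_zero,
        entry_proj_of_ne F hχ A h]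
  · rw [entry_proj_of_notMem F hχ A hb]
    by_contra h
    obtain ⟨a, ha, -⟩ := exists_of_entry_comp_ne _ _ h
    refine ha (entry_retract_of_ne F hχ fun h' => hb ⟨0, a, rfl, Or.inl rfl, h'⟩)

variable (A) in
/-- The decomposition of the object of copies into the original and the copies of higher level. -/
noncomputable def originalDecomp :
    Decomp A (copies F hχ A Set.univ) (copies F hχ A {0}ᶜ) where
  f := embed F hχ (isEmbeddable_zero F)
  r := retract F hχ A
  g := incl F hχ A Set.univ {0}ᶜ
  s := incl F hχ A {0}ᶜ Set.univ
  f_r := embed_retract F hχ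
  s_g := by rw [incl_comp F hχ A (Set.subset_univ _), incl_self]
  total := by
    rw [retract_embed]
    exact proj_add_proj F hχ A isCompl_compl

variable (A) in
/-- The projection to the part over `χ`. -/
noncomputable def cutoff : A ⟶ A :=
  Chart.hom (Chart.refl A) (Chart.refl A) (𝟙 A) (fun a b => a ∈ χ ∧ a = b)
    (fun g a b => by rw [hχ.act, actFst_inj])
    (fun b _ => (Set.finite_singleton b).subset fun _ h => h.1.2)
    (fun a _ => (Set.finite_singleton a).subset fun _ h => h.1.2.symm)
    (isUniform_eq.mono (by
      rintro x x' ⟨b, b', ⟨-, rfl⟩, -, -, -, rfl, rfl⟩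
      rfl))

theorem entry_cutoff_of_mem {a : Y × Ray} (h : a ∈ χ) : entry (cutoff hχ A) a a = 𝟙 _ := by
  refine (if_pos ⟨h, rfl⟩).trans ?_
  change 𝟙 _ ≫ entry (𝟙 A) a a ≫ 𝟙 _ = _
  rw [entry_one_self, Category.id_comp, Category.id_comp]

theorem entry_cutoff_of_not {a b : Y × Ray} (h : ¬ (a ∈ χ ∧ a = b)) :
    entry (cutoff hχ A) a b = 0 := if_neg h

theorem entry_cutoff_comp {B : Obstr R G p} (ψ : A ⟶ B) (a b : Y × Ray) :
    entry (cutoff hχ A ≫ ψ) a b = entry (cutoff hχ A) a a ≫ entry ψ a b :=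
  entry_comp_of_left _ _ fun _ hb => entry_cutoff_of_not hχ fun h => hb h.2.symm

theorem cutoff_embed : cutoff hχ A ≫ embed F hχ (isEmbeddable_zero F) =
    embed F hχ (isEmbeddable_of_isNarrow F hχ 0) := by
  refine hom_ext fun a b => ?_
  rw [entry_cutoff_comp]
  by_cases h : a ∈ χ ∧ F.pos 0 a = b
  · rw [entry_cutoff_of_mem hχ h.1, entry_embed F hχ _ h,
      entry_embed F hχ (isEmbeddable_zero F) ⟨Set.mem_univ _, h.2⟩,
      Category.id_comp]
  · rw [entry_embed_of_not F hχ _ h]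
    by_cases ha : a ∈ χ
    · rw [entry_embed_of_not F hχ _ fun h' => h ⟨ha, h'.2⟩, Limits.comp_zero]
    · rw [entry_cutoff_of_not hχ fun h' => ha h'.1, Limits.zero_comp]

/-- An involution of the set of levels which moves levels by at most one. -/
structure IsLevelSwap (τ : ℕ → ℕ) : Prop where
  invol : ∀ k, τ (τ k) = k
  le : ∀ k : ℕ, |(k : ℝ) - τ k| ≤ 1

variable (χ) in
-- The crux of the swindle: although infinitely many levels occur, heights change by at most one
-- more than under φ, and both ends of a component are copies near one common cut.
theorem isUniform_shift {φ : A ⟶ A} (hφ : IsControlled (1 / 30) φ) {τ : ℕ → ℕ}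
    (hχ : IsNarrow G p χ) (hτ : IsLevelSwap τ) :
    IsUniform fun x x' => ∃ k a a', a ∈ χ ∧ a' ∈ χ ∧ entry φ a a' ≠ 0 ∧
      x = (p (F.pos k a).1, (F.pos k a).2) ∧ x' = (p (F.pos (τ k) a').1, (F.pos (τ k) a').2) := by
  obtain ⟨⟨δ, hδ⟩, -⟩ := isUniform_entry F φ
  refine ⟨⟨δ + 1, ?_⟩, fun ε hε => ?_⟩
  · rintro x x' ⟨k, a, a', -, -, h, rfl, rfl⟩
    have h1 := hδ _ _ ⟨a, a', h, rfl, rfl⟩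
    change |((F.pos k a).2 : ℝ) - (F.pos (τ k) a').2| ≤ _
    rw [F.pos_snd, F.pos_snd, add_sub_add_comm]
    exact (abs_add_le _ _).trans (add_le_add h1 (hτ.le k))
  · obtain ⟨T, hT⟩ := hχ.exists_newX_near F (ε / 2) (by positivity)
    refine ⟨T, ?_⟩
    rintro x x' ⟨k, a, a', ha, ha', h, rfl, rfl⟩ h1 h2
    obtain ⟨n, hn⟩ := hχ.near a ha
    obtain ⟨n', hn'⟩ := hχ.near a' ha'
    have h3 := hφ a a' h
    rw [Real.dist_eq] at h3
    -- 14/30 + 1/30 + 14/30 < 1.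
    have h4 : n = n' := cut_unique (x := p a.1) (x' := p a'.1) (by linarith)
    subst h4
    have h5 := hT a ha k h1 n hn
    have h6 := hT a' ha' (τ k) h2 n hn'
    change dist (p (F.pos k a).1) (p (F.pos (τ k) a').1) < ε
    rw [F.p_pos, F.p_pos, Real.dist_eq]
    rw [abs_sub_comm] at h6
    have h7 := abs_sub_le (F.newX k a) (n + 1 / 2) (F.newX (τ k) a')
    linarith

/-- The endomorphism of the object of copies which applies the part of `φ` over `χ` and changes the
levels by `τ`. -/
noncomputable def shift {φ : A ⟶ A} (hφ : IsControlled (1 / 30) φ) {τ : ℕ → ℕ}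
    (hτ : IsLevelSwap τ) : copies F hχ A Set.univ ⟶ copies F hχ A Set.univ :=
  Chart.hom (copiesChart F hχ A Set.univ) (copiesChart F hχ A Set.univ) φ
    (fun b b' => ∃ k a a', a ∈ χ ∧ a' ∈ χ ∧ b = F.pos k a ∧ b' = F.pos (τ k) a')
    (fun g b b' => by
      have key : ∀ (g : G) b b', (∃ k a a', a ∈ χ ∧ a' ∈ χ ∧ b = F.pos k a ∧
          b' = F.pos (τ k) a') → ∃ k a a', a ∈ χ ∧ a' ∈ χ ∧ actFst g b = F.pos k a ∧
          actFst g b' = F.pos (τ k) a' := by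
        rintro g b b' ⟨k, a, a', ha, ha', rfl, rfl⟩
        exact ⟨k, actFst g a, actFst g a', (hχ.act g a).2 ha, (hχ.act g a').2 ha',
          (F.pos_act _ _ _).symm, (F.pos_act _ _ _).symm⟩
      refine ⟨fun h => ?_, key g b b'⟩
      have h' := key g⁻¹ _ _ h
      simpa [actFst] using h')
    -- The target determines the level `τ k`, hence `k` since `τ` is an involution; together with
    -- the prescribed original `a` this determines the source.
    (fun b' a => Set.Subsingleton.finite (by
      rintro _ ⟨⟨k, a₁, a₁', h₁, h₁', rfl, e₁⟩, -, f₁⟩ _ ⟨⟨l, a₂, a₂', h₂, h₂', rfl, e₂⟩, -, f₂⟩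
      have hk : τ k = τ l := (pos_inj F hχ (Or.inr h₁') (Or.inr h₂') (e₁.symm.trans e₂)).1
      have hkl : k = l := by rw [← hτ.invol k, hk, hτ.invol]
      rw [show a₁ = a from (orig_pos F hχ (Or.inr h₁)).symm.trans f₁,
        show a₂ = a from (orig_pos F hχ (Or.inr h₂)).symm.trans f₂, hkl]))
    (fun b a => Set.Subsingleton.finite (by
      rintro _ ⟨⟨k, a₁, a₁', h₁, h₁', e₁, rfl⟩, -, f₁⟩ _ ⟨⟨l, a₂, a₂', h₂, h₂', e₂, rfl⟩, -, f₂⟩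
      have hk : k = l := (pos_inj F hχ (Or.inr h₁) (Or.inr h₂) (e₁.symm.trans e₂)).1
      rw [show a₁' = a from (orig_pos F hχ (Or.inr h₁')).symm.trans f₁,
        show a₂' = a from (orig_pos F hχ (Or.inr h₂')).symm.trans f₂, hk]))
    ((isUniform_shift F χ hφ hχ hτ).mono (by
      rintro x x' ⟨_, _, ⟨k, a, a', ha, ha', rfl, rfl⟩, -, -, h, rfl, rfl⟩
      refine ⟨k, a, a', ha, ha', ?_, rfl, rfl⟩
      change entry φ (orig F χ (F.pos k a)) (orig F χ (F.pos (τ k) a')) ≠ 0 at h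
      rwa [orig_pos F hχ (Or.inr ha), orig_pos F hχ (Or.inr ha')] at h))

theorem entry_shift_ne_zero {φ : A ⟶ A} (hφ : IsControlled (1 / 30) φ) {τ : ℕ → ℕ}
    (hτ : IsLevelSwap τ) {b b' : Y × Ray} (h : entry (shift F hχ hφ hτ) b b' ≠ 0) :
    entry φ (orig F χ b) (orig F χ b') ≠ 0 := by
  intro h'
  refine h ?_
  have key : copyDown F hχ A Set.univ b ≫ entry φ (orig F χ b) (orig F χ b') ≫
      copyUp F hχ A Set.univ b' = 0 := by
    rw [h', Limits.zero_comp, Limits.comp_zero]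
  by_cases hD : ∃ k a a', a ∈ χ ∧ a' ∈ χ ∧ b = F.pos k a ∧ b' = F.pos (τ k) a'
  · exact (if_pos hD).trans key
  · exact if_neg hD

/-- This reduces calculations in the object of copies to calculations with φ. Truncation to χ occurs
at both ends: in `cutoff` and in the embedding of level `τ k`. -/
theorem embed_shift {φ : A ⟶ A} (hφ : IsControlled (1 / 30) φ) {τ : ℕ → ℕ}
    (hτ : IsLevelSwap τ) (k : ℕ) :
    embed F hχ (isEmbeddable_of_isNarrow F hχ k) ≫ shift F hχ hφ hτ =
      cutoff hχ A ≫ φ ≫ embed F hχ (isEmbeddable_of_isNarrow F hχ (τ k)) := by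
  refine hom_ext fun a b' => ?_
  rw [entry_embed_comp, entry_cutoff_comp]
  by_cases ha : a ∈ χ
  · rw [entry_cutoff_of_mem hχ ha, Category.id_comp, entry_embed F hχ _ ⟨ha, rfl⟩]
    by_cases h : ∃ a' ∈ χ, b' = F.pos (τ k) a'
    · obtain ⟨a', ha', rfl⟩ := h
      have h2 : orig F χ (F.pos k a) = a := orig_pos F hχ (Or.inr ha)
      have h3 : orig F χ (F.pos (τ k) a') = a' := orig_pos F hχ (Or.inr ha')
      rw [entry_comp_of_right (b := a') _ _ fun c hc => entry_embed_of_not F hχ _ fun h' =>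
        hc (pos_inj F hχ (Or.inr h'.1) (Or.inr ha') h'.2).2, entry_embed F hχ _ ⟨ha', rfl⟩]
      have h4 : entry (shift F hχ hφ hτ) (F.pos k a) (F.pos (τ k) a') =
          copyDown F hχ A Set.univ (F.pos k a) ≫
          entry φ (orig F χ (F.pos k a)) (orig F χ (F.pos (τ k) a')) ≫
          copyUp F hχ A Set.univ (F.pos (τ k) a') :=
        if_pos ⟨k, a, a', ha, ha', rfl, rfl⟩
      rw [h4, Category.assoc, copyUp_copyDown F hχ A ⟨k, a, Set.mem_univ _, Or.inr ha, rfl⟩]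
      -- The types depend on `orig`; generalizing the remaining factor and both originals allows the
      -- equalities to be substituted.
      generalize copyUp F hχ A Set.univ (F.pos (τ k) a') = w
      revert w
      generalize orig F χ (F.pos (τ k) a') = c' at h3
      generalize orig F χ (F.pos k a) = c at h2
      subst h2 h3
      intro w
      rw [entry_one_self, Category.id_comp, entry_one_self, Category.id_comp]
    · have h4 : entry (shift F hχ hφ hτ) (F.pos k a) b' = 0 := if_neg (by
        rintro ⟨l, a₁, a₁', h₁, h₁', e, e'⟩
        have hk : k = l := (pos_inj F hχ (Or.inr ha) (Or.inr h₁) e).1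
        subst hk
        exact h ⟨a₁', h₁', e'⟩)
      rw [h4, Limits.comp_zero]
      symm
      by_contra h5
      obtain ⟨c, -, hc⟩ := exists_of_entry_comp_ne _ _ h5
      exact hc (entry_embed_of_not F hχ _ fun h' => h ⟨c, h'.1, h'.2.symm⟩)
  · rw [entry_cutoff_of_not hχ fun h => ha h.1, entry_embed_of_not F hχ _ fun h => ha h.1,
      Limits.zero_comp, Limits.zero_comp]

end CopyMorphisms
-- Multiplication in `Aut` is opposite to `≪≫`; the order does not matter since `K₁` is abelian.
theorem K1.cls_trans {C : Type*} [Category C] [Preadditive C] {X : C} (f g : Aut X) :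
    K1.cls (f ≪≫ g : Aut X) = K1.cls f + K1.cls g := by
  rw [add_comm]
  exact K1.cls_mul g f

/-! ### Truncated Whitehead products -/

section Swindle

open Obstr

variable {R : Type u} [Ring R] {G : Type*} [Group G] [MulAction G ℝ] [IsIsometricSMul G ℝ]
  {Y : Type*} [TopologicalSpace Y] [MulAction G Y] {p : Y → ℝ} (F : Frame G p)
  {χ : Set (Y × Ray)} (hχ : IsNarrow G p χ) {A : Obstr R G p}

/-- The elementary automorphism which adds the part of `φ` over `χ`, from the levels in `P` to the
levels given by `τ`. -/
noncomputable def elem {φ : A ⟶ A} (hφ : IsControlled (1 / 30) φ) {τ : ℕ → ℕ}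
    (hτ : IsLevelSwap τ) (P : Set ℕ) : Aut (copies F hχ A Set.univ) :=
  (levelDecomp F hχ A (isCompl_compl (x := P))).elementary
    (incl F hχ A P Set.univ ≫ shift F hχ hφ hτ ≫ incl F hχ A Set.univ Pᶜ)

theorem cls_elem {φ : A ⟶ A} (hφ : IsControlled (1 / 30) φ) {τ : ℕ → ℕ}
    (hτ : IsLevelSwap τ) (P : Set ℕ) : K1.cls (elem F hχ hφ hτ P) = 0 :=
  Decomp.cls_elementary _ _

theorem elem_hom {φ : A ⟶ A} (hφ : IsControlled (1 / 30) φ) {τ : ℕ → ℕ}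
    (hτ : IsLevelSwap τ) (P : Set ℕ) : (elem F hχ hφ hτ P).hom =
      𝟙 _ + proj F hχ A P ≫ shift F hχ hφ hτ ≫ proj F hχ A Pᶜ := by
  simp [elem, proj]

/-- The embedding of the part over `χ` as copies of level `k`. -/
noncomputable abbrev emb (k : ℕ) : A ⟶ copies F hχ A Set.univ :=
  embed F hχ (isEmbeddable_of_isNarrow F hχ k)

/-- The condition `x ≫ cutoff hχ A = x` says that `x` lands over χ, where the first truncation in
`embed_shift` is invisible. -/
theorem emb_elem_of_mem {φ : A ⟶ A} (hφ : IsControlled (1 / 30) φ) {τ : ℕ → ℕ}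
    (hτ : IsLevelSwap τ) {P : Set ℕ} {k : ℕ} (hk : k ∈ P) (hk' : τ k ∉ P) {Z : Obstr R G p}
    {x : Z ⟶ A} (hx : x ≫ cutoff hχ A = x) :
    (x ≫ emb F hχ k) ≫ (elem F hχ hφ hτ P).hom =
      x ≫ emb F hχ k + (x ≫ φ) ≫ emb F hχ (τ k) := by
  have h1 := embed_proj_of_mem F hχ (A := A) (isEmbeddable_of_isNarrow F hχ k) hk
  have h2 := embed_proj_of_mem F hχ (A := A) (P := Pᶜ) (isEmbeddable_of_isNarrow F hχ (τ k)) hk'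
  have h3 := embed_shift F hχ hφ hτ k
  have h4 : x ≫ emb F hχ k ≫ proj F hχ A P ≫ shift F hχ hφ hτ ≫ proj F hχ A Pᶜ =
      (x ≫ φ) ≫ emb F hχ (τ k) := by
    calc _ = x ≫ (emb F hχ k ≫ proj F hχ A P) ≫ shift F hχ hφ hτ ≫ proj F hχ A Pᶜ := by
          simp only [Category.assoc]
      _ = x ≫ (emb F hχ k ≫ shift F hχ hφ hτ) ≫ proj F hχ A Pᶜ := by
          rw [h1, Category.assoc]
      _ = (x ≫ cutoff hχ A) ≫ φ ≫ emb F hχ (τ k) ≫ proj F hχ A Pᶜ := by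
          rw [h3]
          simp only [Category.assoc]
      _ = _ := by rw [hx, h2, Category.assoc]
  rw [elem_hom, Preadditive.comp_add, Category.comp_id, Category.assoc, h4]

theorem emb_elem_of_notMem {φ : A ⟶ A} (hφ : IsControlled (1 / 30) φ) {τ : ℕ → ℕ}
    (hτ : IsLevelSwap τ) {P : Set ℕ} {k : ℕ} (hk : k ∉ P) {Z : Obstr R G p} (x : Z ⟶ A) :
    (x ≫ emb F hχ k) ≫ (elem F hχ hφ hτ P).hom = x ≫ emb F hχ k := by
  have h1 := embed_proj_of_notMem F hχ (A := A) (isEmbeddable_of_isNarrow F hχ k) hk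
  have h4 : emb F hχ k ≫ proj F hχ A P ≫ shift F hχ hφ hτ ≫ proj F hχ A Pᶜ = 0 := by
    rw [← Category.assoc, h1, Limits.zero_comp]
  rw [elem_hom, Preadditive.comp_add, Category.comp_id, Category.assoc, h4, Limits.comp_zero,
    add_zero]

theorem IsControlled.neg {ε : ℝ} {φ : A ⟶ A} (hφ : IsControlled ε φ) : IsControlled ε (-φ) :=
  fun a b h => hφ a b fun h' => h (by rw [entry_neg, h', neg_zero])

theorem isControlled_one : IsControlled (1 / 30) (𝟙 A) := fun a b h => by
  rw [eq_of_entry_one_ne h, dist_self]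
  norm_num

theorem IsControlled.sub_one {φ : A ⟶ A} (hφ : IsControlled (1 / 30) φ) :
    IsControlled (1 / 30) (φ - 𝟙 A) := fun a b h => by
  rw [sub_eq_add_neg] at h
  rcases eq_or_of_entry_add_ne h with h | h
  · exact hφ a b h
  · exact IsControlled.neg isControlled_one a b h

/-- The product of elementary automorphisms which, away from the boundary of `χ`, is `α` on the
levels in `P` and the inverse of `α` on the levels in `Q`. -/
noncomputable def pairAut {α : Aut A} (hα : IsEpsAut (1 / 30) α) {τ : ℕ → ℕ}
    (hτ : IsLevelSwap τ) (P Q : Set ℕ) : Aut (copies F hχ A Set.univ) :=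
  elem F hχ hα.1 hτ P ≪≫ elem F hχ (IsControlled.neg hα.2) hτ Q ≪≫
    elem F hχ (IsControlled.sub_one hα.1) hτ P ≪≫ elem F hχ isControlled_one hτ Q ≪≫
    elem F hχ (IsControlled.neg isControlled_one) hτ P

theorem cls_pairAut {α : Aut A} (hα : IsEpsAut (1 / 30) α) {τ : ℕ → ℕ}
    (hτ : IsLevelSwap τ) (P Q : Set ℕ) : K1.cls (pairAut F hχ hα hτ P Q) = 0 := by
  refine (K1.cls_trans _ _).trans ?_
  rw [cls_elem, zero_add]
  refine (K1.cls_trans _ _).trans ?_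
  rw [cls_elem, zero_add]
  refine (K1.cls_trans _ _).trans ?_
  rw [cls_elem, zero_add]
  refine (K1.cls_trans _ _).trans ?_
  rw [cls_elem, cls_elem, add_zero]

theorem pairAut_hom {α : Aut A} (hα : IsEpsAut (1 / 30) α) {τ : ℕ → ℕ}
    (hτ : IsLevelSwap τ) (P Q : Set ℕ) : (pairAut F hχ hα hτ P Q).hom =
      (elem F hχ hα.1 hτ P).hom ≫ (elem F hχ (IsControlled.neg hα.2) hτ Q).hom ≫
      (elem F hχ (IsControlled.sub_one hα.1) hτ P).hom ≫
      (elem F hχ isControlled_one hτ Q).hom ≫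
      (elem F hχ (IsControlled.neg isControlled_one) hτ P).hom := rfl

section

variable {α : Aut A} (hα : IsEpsAut (1 / 30) α) {τ : ℕ → ℕ} (hτ : IsLevelSwap τ) {P Q : Set ℕ}
  (hPQ : Disjoint P Q) (hP : ∀ k ∈ P, τ k ∈ Q) (hQ : ∀ k ∈ Q, τ k ∈ P) {Z : Obstr R G p}

include hPQ hP in
-- Write x@k for `x` placed at level `k`. The factors in turn give x@k, then x@k + y@τk, then y@τk
-- (unchanged by the third factor), then y@τk + y@k, and finally y@k. Both `x` and `y` must land
-- over χ for this untruncated calculation.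
theorem emb_pairAut_left {k : ℕ} (hk : k ∈ P) {x y : Z ⟶ A} (hx : x ≫ cutoff hχ A = x)
    (hy : y ≫ cutoff hχ A = y) (hxy : x ≫ α.hom = y) (hyx : y ≫ α.inv = x) :
    (x ≫ emb F hχ k) ≫ (pairAut F hχ hα hτ P Q).hom = y ≫ emb F hχ k := by
  have hkQ := Set.disjoint_left.1 hPQ hk
  have hτQ := hP k hk
  have hτP := Set.disjoint_right.1 hPQ hτQ
  have hττ := hτ.invol k
  have hkQ' : τ (τ k) ∉ Q := hττ.symm ▸ hkQ
  have s1 := emb_elem_of_mem F hχ hα.1 hτ hk hτP hx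
  have s2 := emb_elem_of_notMem F hχ (IsControlled.neg hα.2) hτ hkQ x
  have s3 := emb_elem_of_mem F hχ (IsControlled.neg hα.2) hτ hτQ hkQ' hy
  have s4 := emb_elem_of_notMem F hχ (IsControlled.sub_one hα.1) hτ hτP y
  have s5 := emb_elem_of_mem F hχ isControlled_one hτ hτQ hkQ' hy
  have s6 := emb_elem_of_notMem F hχ (IsControlled.neg isControlled_one) hτ hτP y
  have s7 := emb_elem_of_mem F hχ (IsControlled.neg isControlled_one) hτ hk hτP hy
  rw [hxy] at s1
  rw [hττ, Preadditive.comp_neg, hyx, Preadditive.neg_comp] at s3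
  rw [hττ, Category.comp_id] at s5
  rw [Preadditive.comp_neg, Category.comp_id, Preadditive.neg_comp] at s7
  rw [pairAut_hom, ← Category.assoc, s1, ← Category.assoc, Preadditive.add_comp, s2, s3,
    add_comm (y ≫ _), add_neg_cancel_left, ← Category.assoc, s4, ← Category.assoc, s5,
    Preadditive.add_comp, s6, s7]
  abel

include hPQ hQ in
-- Starting from y@k, unchanged by the first factor, the next ones give y@k - x@τk, then x@k - x@τk,
-- then x@k, which the last factor fixes.
theorem emb_pairAut_right {k : ℕ} (hk : k ∈ Q) {x y : Z ⟶ A} (hx : x ≫ cutoff hχ A = x)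
    (hy : y ≫ cutoff hχ A = y) (hxy : x ≫ α.hom = y) (hyx : y ≫ α.inv = x) :
    (y ≫ emb F hχ k) ≫ (pairAut F hχ hα hτ P Q).hom = x ≫ emb F hχ k := by
  have hkP := Set.disjoint_right.1 hPQ hk
  have hτP := hQ k hk
  have hτQ := Set.disjoint_left.1 hPQ hτP
  have hττ := hτ.invol k
  have hkP' : τ (τ k) ∉ P := hττ.symm ▸ hkP
  have s1 := emb_elem_of_notMem F hχ hα.1 hτ hkP y
  have s2 := emb_elem_of_mem F hχ (IsControlled.neg hα.2) hτ hk hτQ hy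
  have s3 := emb_elem_of_notMem F hχ (IsControlled.sub_one hα.1) hτ hkP y
  have s4 := emb_elem_of_mem F hχ (IsControlled.sub_one hα.1) hτ hτP hkP' hx
  have s5 := emb_elem_of_mem F hχ isControlled_one hτ hk hτQ hx
  have s5' := emb_elem_of_notMem F hχ isControlled_one hτ hτQ x
  have s6 := emb_elem_of_notMem F hχ (IsControlled.neg isControlled_one) hτ hkP x
  have s7 := emb_elem_of_mem F hχ (IsControlled.neg isControlled_one) hτ hτP hkP' hx
  rw [Preadditive.comp_neg, hyx, Preadditive.neg_comp] at s2
  rw [hττ, Preadditive.comp_sub, hxy, Category.comp_id, Preadditive.sub_comp] at s4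
  have s8 : (y ≫ emb F hχ k + -(x ≫ emb F hχ (τ k))) ≫
      (elem F hχ (IsControlled.sub_one hα.1) hτ P).hom =
      x ≫ emb F hχ k + -(x ≫ emb F hχ (τ k)) := by
    rw [Preadditive.add_comp, s3, Preadditive.neg_comp, s4]
    abel
  rw [Category.comp_id] at s5
  have s9 : (x ≫ emb F hχ k + -(x ≫ emb F hχ (τ k))) ≫
      (elem F hχ isControlled_one hτ Q).hom = x ≫ emb F hχ k := by
    rw [Preadditive.add_comp, s5, Preadditive.neg_comp, s5']
    abel
  rw [pairAut_hom, ← Category.assoc, s1, ← Category.assoc, s2, ← Category.assoc, s8,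
    ← Category.assoc, s9, s6]

theorem emb_pairAut_of_notMem {k : ℕ} (hk : k ∉ P) (hk' : k ∉ Q) (x : Z ⟶ A) :
    (x ≫ emb F hχ k) ≫ (pairAut F hχ hα hτ P Q).hom = x ≫ emb F hχ k := by
  have s1 := emb_elem_of_notMem F hχ hα.1 hτ hk x
  have s2 := emb_elem_of_notMem F hχ (IsControlled.neg hα.2) hτ hk' x
  have s3 := emb_elem_of_notMem F hχ (IsControlled.sub_one hα.1) hτ hk x
  have s4 := emb_elem_of_notMem F hχ isControlled_one hτ hk' x
  have s5 := emb_elem_of_notMem F hχ (IsControlled.neg isControlled_one) hτ hk x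
  rw [pairAut_hom, ← Category.assoc, s1, ← Category.assoc, s2, ← Category.assoc, s3,
    ← Category.assoc, s4, s5]

/-- The automorphism of the object of copies which is `α` on the copies of level `0`. -/
noncomputable def extendAut (α : Aut A) : Aut (copies F hχ A Set.univ) :=
  (originalDecomp F hχ A).extend α

theorem extendAut_hom (α : Aut A) : (extendAut F hχ α).hom =
    retract F hχ A ≫ α.hom ≫ embed F hχ (isEmbeddable_zero F) + proj F hχ A {0}ᶜ := rfl

theorem emb_extendAut_zero {x y : Z ⟶ A} (hx : x ≫ cutoff hχ A = x)
    (hy : y ≫ cutoff hχ A = y) (hxy : x ≫ α.hom = y) :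
    (x ≫ emb F hχ 0) ≫ (extendAut F hχ α).hom = y ≫ emb F hχ 0 := by
  have h0 := cutoff_embed F hχ (A := A)
  have h1 : ∀ z : Z ⟶ A, z ≫ cutoff hχ A = z → z ≫ emb F hχ 0 =
      z ≫ embed F hχ (isEmbeddable_zero F) := fun z hz => by
    rw [emb, ← h0, ← Category.assoc, hz]
  have h3 := embed_proj_of_notMem F hχ (A := A) (P := {0}ᶜ) (isEmbeddable_zero F) (by simp)
  have h4 : embed F hχ (isEmbeddable_zero F) ≫ (extendAut F hχ α).hom =
      α.hom ≫ embed F hχ (isEmbeddable_zero F) := by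
    rw [extendAut_hom, Preadditive.comp_add, h3, add_zero, ← Category.assoc, embed_retract,
      Category.id_comp]
  rw [h1 x hx, Category.assoc, h4, ← Category.assoc, hxy, h1 y hy]

theorem emb_extendAut_of_ne_zero {k : ℕ} (hk : k ≠ 0) (x : Z ⟶ A) :
    (x ≫ emb F hχ k) ≫ (extendAut F hχ α).hom = x ≫ emb F hχ k := by
  have h1 := embed_proj_of_mem F hχ (A := A) (P := {0}ᶜ) (isEmbeddable_of_isNarrow F hχ k) hk
  have h2 := embed_proj_of_notMem F hχ (A := A) (P := {0}) (isEmbeddable_of_isNarrow F hχ k) hk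
  have h3 : emb F hχ k ≫ retract F hχ A = 0 := by
    have h := congrArg (· ≫ retract F hχ A) h2
    rw [← retract_embed, Category.assoc, Category.assoc, embed_retract, Category.comp_id,
      Limits.zero_comp] at h
    exact h
  rw [extendAut_hom, Preadditive.comp_add, Category.assoc, Category.assoc, h1,
    ← Category.assoc (emb F hχ k), h3, Limits.zero_comp, Limits.comp_zero, zero_add]

end

end Swindle
-- Reach of the swindle and its cancellation near the cuts
section Restriction

open Obstr

variable {R : Type u} [Ring R] {G : Type*} [Group G] [MulAction G ℝ] [IsIsometricSMul G ℝ]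
  {Y : Type*} [TopologicalSpace Y] [MulAction G Y] {p : Y → ℝ} (F : Frame G p)
  {χ : Set (Y × Ray)} (hχ : IsNarrow G p χ) {A : Obstr R G p} (α : Aut A)

/-- `φ` moves points at most `n` steps in the graph of adjacent points and crosses cuts only
between adjacent points. -/
def IsReach (n : ℕ) (φ : copies F hχ A Set.univ ⟶ copies F hχ A Set.univ) : Prop :=
  ∀ b b', entry φ b b' ≠ 0 → ∀ j, orig F χ b ∉ cutNbhd α (n + j) →
    orig F χ b' ∉ cutNbhd α j ∧ F.cell (orig F χ b) = F.cell (orig F χ b')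

variable {α}

theorem IsReach.comp {m n : ℕ} {φ ψ : copies F hχ A Set.univ ⟶ copies F hχ A Set.univ}
    (hφ : IsReach F hχ α m φ) (hψ : IsReach F hχ α n ψ) : IsReach F hχ α (m + n) (φ ≫ ψ) := by
  intro b b'' h j hj
  obtain ⟨b', h1, h2⟩ := exists_of_entry_comp_ne φ ψ h
  obtain ⟨h3, h4⟩ := hφ b b' h1 (n + j) (by rwa [← add_assoc])
  obtain ⟨h5, h6⟩ := hψ b' b'' h2 j h3
  exact ⟨h5, h4.trans h6⟩

/-- An edge ending in `cutNbhd α j` starts in `cutNbhd α (j + 1)`, and an edge changing the cell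
starts in `cutNbhd α 0` because a cut lies between its ends. -/
theorem isReach_one {φ : copies F hχ A Set.univ ⟶ copies F hχ A Set.univ}
    (h : ∀ b b', entry φ b b' ≠ 0 →
      orig F χ b = orig F χ b' ∨ Adj α (orig F χ b) (orig F χ b')) : IsReach F hχ α 1 φ := by
  intro b b' hb j hj
  rw [add_comm] at hj
  rcases h b b' hb with h | h
  · exact ⟨fun h' => hj (Or.inl (h ▸ h')), congrArg _ h⟩
  · refine ⟨fun h' => hj (Or.inr ⟨_, h', h⟩), ?_⟩
    by_contra hc
    exact hj (cutNbhd_mono α (Nat.zero_le _) ⟨_, h, F.exists_cut_of_cell_ne hc⟩)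

theorem eq_of_entry_proj_ne {P : Set ℕ} {b b' : Y × Ray} (h : entry (proj F hχ A P) b b' ≠ 0) :
    b = b' := by
  by_contra hb
  exact h (entry_proj_of_ne F hχ A hb)

theorem isReach_elem {φ : A ⟶ A} (hφ : IsControlled (1 / 30) φ) {τ : ℕ → ℕ}
    (hτ : IsLevelSwap τ) (P : Set ℕ) (h : ∀ a a', entry φ a a' ≠ 0 → a = a' ∨ Adj α a a') :
    IsReach F hχ α 1 (elem F hχ hφ hτ P).hom := by
  refine isReach_one F hχ fun b b' hb => ?_
  rw [elem_hom] at hb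
  rcases eq_or_of_entry_add_ne hb with hb | hb
  · exact Or.inl (congrArg _ (eq_of_entry_one_ne hb))
  · obtain ⟨c, h1, h2⟩ := exists_of_entry_comp_ne _ _ hb
    obtain ⟨d, h3, h4⟩ := exists_of_entry_comp_ne _ _ h2
    obtain rfl := eq_of_entry_proj_ne F hχ h1
    obtain rfl := eq_of_entry_proj_ne F hχ h4
    exact h _ _ (entry_shift_ne_zero F hχ hφ hτ h3)

theorem isReach_pairAut (hα : IsEpsAut (1 / 30) α) {τ : ℕ → ℕ} (hτ : IsLevelSwap τ)
    (P Q : Set ℕ) : IsReach F hχ α 5 (pairAut F hχ hα hτ P Q).hom := by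
  rw [pairAut_hom]
  have one : ∀ a a', entry (𝟙 A) a a' ≠ 0 → a = a' ∨ Adj α a a' := fun a a' h =>
    Or.inl (eq_of_entry_one_ne h)
  have neg : ∀ {φ : A ⟶ A}, (∀ a a', entry φ a a' ≠ 0 → a = a' ∨ Adj α a a') →
      ∀ a a', entry (-φ) a a' ≠ 0 → a = a' ∨ Adj α a a' := fun {φ} h a a' h' =>
    h a a' fun h0 => h' (by rw [entry_neg, h0, neg_zero])
  have h1 : ∀ a a', entry α.hom a a' ≠ 0 → a = a' ∨ Adj α a a' := fun a a' h =>
    Or.inr (Or.inl (Or.inl h))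
  have h2 : ∀ a a', entry α.inv a a' ≠ 0 → a = a' ∨ Adj α a a' := fun a a' h =>
    Or.inr (Or.inr (Or.inl h))
  have h3 : ∀ a a', entry (α.hom - 𝟙 A) a a' ≠ 0 → a = a' ∨ Adj α a a' := fun a a' h => by
    rw [sub_eq_add_neg] at h
    exact (eq_or_of_entry_add_ne h).elim (h1 a a') (neg one a a')
  exact (isReach_elem F hχ _ hτ P h1).comp F hχ ((isReach_elem F hχ _ hτ Q (neg h2)).comp F hχ
    ((isReach_elem F hχ _ hτ P h3).comp F hχ ((isReach_elem F hχ _ hτ Q one).comp F hχ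
      (isReach_elem F hχ _ hτ P (neg one)))))

theorem isReach_extendAut : IsReach F hχ α 1 (extendAut F hχ α).hom := by
  refine isReach_one F hχ fun b b' hb => ?_
  rw [extendAut_hom] at hb
  rcases eq_or_of_entry_add_ne hb with hb | hb
  · obtain ⟨a, h1, h2⟩ := exists_of_entry_comp_ne _ _ hb
    obtain ⟨a', h3, h4⟩ := exists_of_entry_comp_ne _ _ h2
    have e1 : F.pos 0 a = b := by
      by_contra h
      exact h1 (entry_retract_of_ne F hχ h)
    have e2 : F.pos 0 a' = b' := by
      by_contra h
      exact h4 (entry_embed_of_not F hχ _ fun h' => h h'.2)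
    subst e1 e2
    rw [orig_pos F hχ (Or.inl rfl), orig_pos F hχ (Or.inl rfl)]
    exact Or.inr (Or.inl (Or.inl h3))
  · exact Or.inl (congrArg _ (eq_of_entry_proj_ne F hχ hb))

/-- For `a ∈ Q` the entry of the embedding at `F.pos k a` is invertible and can be cancelled. This
turns levelwise identities back into statements about entries. -/
theorem entry_eq_zero_of_embed_comp {k : ℕ} {Q : Set (Y × Ray)} (hQ : IsEmbeddable F χ k Q)
    {B : Obstr R G p} {ψ : copies F hχ A Set.univ ⟶ B} {a : Y × Ray} (ha : a ∈ Q) {c : Y × Ray}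
    (h : entry (embed F hχ hQ ≫ ψ) a c = 0) : entry ψ (F.pos k a) c = 0 := by
  have h2 : orig F χ (F.pos k a) = a := orig_pos F hχ (hQ.valid a ha)
  rw [entry_embed_comp, entry_embed F hχ hQ ⟨ha, rfl⟩, Category.assoc] at h
  have h3 := congrArg (entry (𝟙 A) (orig F χ (F.pos k a)) a ≫ ·) h
  simp only [Limits.comp_zero] at h3
  rw [← Category.assoc, entry_one_comp_entry_one A h2.symm, entry_one_self, Category.id_comp] at h3
  rw [← Category.id_comp (entry ψ _ _), ← copyDown_copyUp, Category.assoc, h3, Limits.comp_zero]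

theorem cutoff_comp_cutoff {χ' : Set (Y × Ray)} (hχ' : IsNarrow G p χ') {φ : A ⟶ A}
    (h : ∀ a ∈ χ', ∀ a', entry φ a a' ≠ 0 → a' ∈ χ) :
    (cutoff hχ' A ≫ φ) ≫ cutoff hχ A = cutoff hχ' A ≫ φ := by
  rw [Category.assoc]
  refine hom_ext fun a a' => ?_
  rw [entry_cutoff_comp, entry_cutoff_comp]
  by_cases ha : a ∈ χ'
  · congr 1
    rw [entry_comp_of_right (b := a') _ _ fun c hc => entry_cutoff_of_not hχ fun h' => hc h'.2]
    by_cases ha' : entry φ a a' = 0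
    · rw [ha', Limits.zero_comp]
    · rw [entry_cutoff_of_mem hχ (h a ha a' ha'), Category.comp_id]
  · rw [entry_cutoff_of_not hχ' fun h' => ha h'.1, Limits.zero_comp, Limits.zero_comp]

/-- The involution exchanging `2 * i + 1` and `2 * i + 2`. -/
def swapOdd (k : ℕ) : ℕ := if k = 0 then 0 else if k % 2 = 1 then k + 1 else k - 1

/-- The involution exchanging `2 * i` and `2 * i + 1`. -/
def swapEven (k : ℕ) : ℕ := if k % 2 = 0 then k + 1 else k - 1

theorem IsLevelSwap.mk' {τ : ℕ → ℕ} (h : ∀ k, τ (τ k) = k) (h' : ∀ k, k ≤ τ k + 1) :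
    IsLevelSwap τ := by
  refine ⟨h, fun k => ?_⟩
  have h1 : (k : ℝ) ≤ τ k + 1 := by exact_mod_cast h' k
  have h2 : (τ k : ℝ) ≤ k + 1 := by
    have := h' (τ k)
    rw [h] at this
    exact_mod_cast this
  rw [abs_le]
  constructor <;> linarith

theorem isLevelSwap_swapOdd : IsLevelSwap swapOdd :=
  IsLevelSwap.mk' (fun k => by grind [swapOdd]) fun k => by grind [swapOdd]

theorem isLevelSwap_swapEven : IsLevelSwap swapEven :=
  IsLevelSwap.mk' (fun k => by grind [swapEven]) fun k => by grind [swapEven]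

section

variable (hα : IsEpsAut (1 / 30) α)

/-- The automorphism obtained from `α` by the swindle. -/
noncomputable def swindle : Aut (copies F hχ A Set.univ) :=
  extendAut F hχ α ≪≫ pairAut F hχ hα isLevelSwap_swapOdd {k | k ≠ 0 ∧ k % 2 = 0} {k | k % 2 = 1} ≪≫
    pairAut F hχ hα isLevelSwap_swapEven {k | k % 2 = 1} {k | k % 2 = 0}

theorem swindle_hom : (swindle F hχ hα).hom = (extendAut F hχ α).hom ≫
    (pairAut F hχ hα isLevelSwap_swapOdd {k | k ≠ 0 ∧ k % 2 = 0} {k | k % 2 = 1}).hom ≫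
    (pairAut F hχ hα isLevelSwap_swapEven {k | k % 2 = 1} {k | k % 2 = 0}).hom := rfl

theorem cls_swindle : K1.cls (swindle F hχ hα) = K1.cls α := by
  refine (K1.cls_trans _ _).trans ?_
  rw [show K1.cls (extendAut F hχ α) = K1.cls α from Decomp.cls_extend _ _]
  refine add_eq_left.2 ((K1.cls_trans _ _).trans ?_)
  rw [cls_pairAut, cls_pairAut, add_zero]

theorem isReach_swindle : IsReach F hχ α 11 (swindle F hχ hα).hom := by
  rw [swindle_hom]
  exact (isReach_extendAut F hχ).comp F hχ ((isReach_pairAut F hχ hα _ _ _).comp F hχ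
    (isReach_pairAut F hχ hα _ _ _))

/-- Level 0 meets α from the extension and α⁻¹ from the second product, since `swapOdd` leaves it
alone in the first. Positive even levels meet α and then α⁻¹, odd levels α⁻¹ and then α. -/
theorem emb_swindle {Z : Obstr R G p} {x : Z ⟶ A} (hx : x ≫ cutoff hχ A = x)
    (hu : (x ≫ α.hom) ≫ cutoff hχ A = x ≫ α.hom) (hv : (x ≫ α.inv) ≫ cutoff hχ A = x ≫ α.inv)
    (k : ℕ) : (x ≫ emb F hχ k) ≫ (swindle F hχ hα).hom = x ≫ emb F hχ k := by
  have hui : (x ≫ α.hom) ≫ α.inv = x := by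
    have h : α.hom ≫ α.inv = 𝟙 A := Iso.hom_inv_id α
    rw [Category.assoc, h, Category.comp_id]
  have hvi : (x ≫ α.inv) ≫ α.hom = x := by
    have h : α.inv ≫ α.hom = 𝟙 A := Iso.inv_hom_id α
    rw [Category.assoc, h, Category.comp_id]
  have d1 : Disjoint {k : ℕ | k ≠ 0 ∧ k % 2 = 0} {k | k % 2 = 1} :=
    Set.disjoint_left.2 fun k h h' => by
      simp only [Set.mem_ofPred_eq] at h h'
      omega
  have d2 : Disjoint {k : ℕ | k % 2 = 1} {k | k % 2 = 0} :=
    Set.disjoint_left.2 fun k h h' => by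
      simp only [Set.mem_ofPred_eq] at h h'
      omega
  have a1 : ∀ k ∈ {k : ℕ | k ≠ 0 ∧ k % 2 = 0}, swapOdd k ∈ {k : ℕ | k % 2 = 1} := fun k h => by
    simp only [Set.mem_ofPred_eq, swapOdd] at h ⊢
    split_ifs <;> omega
  have a2 : ∀ k ∈ {k : ℕ | k % 2 = 1}, swapOdd k ∈ {k : ℕ | k ≠ 0 ∧ k % 2 = 0} := fun k h => by
    simp only [Set.mem_ofPred_eq, swapOdd] at h ⊢
    split_ifs <;> omega
  have a3 : ∀ k ∈ {k : ℕ | k % 2 = 1}, swapEven k ∈ {k : ℕ | k % 2 = 0} := fun k h => by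
    simp only [Set.mem_ofPred_eq, swapEven] at h ⊢
    grind
  have a4 : ∀ k ∈ {k : ℕ | k % 2 = 0}, swapEven k ∈ {k : ℕ | k % 2 = 1} := fun k h => by
    simp only [Set.mem_ofPred_eq, swapEven] at h ⊢
    grind
  rw [swindle_hom]
  by_cases h0 : k = 0
  · subst h0
    rw [← Category.assoc, emb_extendAut_zero F hχ hx hu rfl, ← Category.assoc,
      emb_pairAut_of_notMem F hχ hα _ (by simp) (by simp),
      emb_pairAut_right F hχ hα _ d2 a4 (by simp) hx hu rfl hui]
  · rw [← Category.assoc, emb_extendAut_of_ne_zero F hχ h0, ← Category.assoc]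
    rcases Nat.mod_two_eq_zero_or_one k with h | h
    · rw [emb_pairAut_left F hχ hα _ d1 a1 ⟨h0, h⟩ hx hu rfl hui,
        emb_pairAut_right F hχ hα _ d2 a4 h hx hu rfl hui]
    -- On odd levels α⁻¹ acts first, so the pair of maps is `x ≫ α.inv` and `x`.
    · rw [emb_pairAut_right F hχ hα _ d1 a2 h hv hx hvi rfl,
        emb_pairAut_left F hχ hα _ d2 a3 h hv hx hvi rfl]

end

end Restriction

/-! ### The theorem for an arbitrary frame -/

open Obstr in
theorem exists_restrictsTo {R : Type u} [Ring R] {G : Type*} [Group G] [MulAction G ℝ]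
    {Y : Type*} [TopologicalSpace Y] [MulAction G Y] {p : Y → ℝ} (F : Frame G p)
    (A : Obstr R G p) (α : Aut A) (hα : IsEpsAut (1 / 30) α) :
    ∃ (B : Obstr R G p) (β : Aut B), K1.cls α = K1.cls β ∧
      RestrictsTo (Set.Ioo (1 / 2) (3 / 2)) β.hom := by
  have := F.isIsometricSMul
  -- 11 is the reach of `swindle`; one step more makes room for α and α⁻¹ applied to the part over
  -- `cutNbhd α 11`.
  have hχ : IsNarrow G p (cutNbhd α 12) := isNarrow_cutNbhd F hα (by norm_num)
  have hW : IsNarrow G p (cutNbhd α 11) := isNarrow_cutNbhd F hα (by norm_num)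
  have hWχ : cutNbhd α 11 ⊆ cutNbhd α 12 := cutNbhd_mono α (by norm_num)
  have key : ∀ b b', entry (swindle F hχ hα).hom b b' ≠ 0 →
      (p b.1 ∈ Set.Ioo (1 / 2 : ℝ) (3 / 2) ↔ p b'.1 ∈ Set.Ioo (1 / 2 : ℝ) (3 / 2)) := by
    intro b b' h
    obtain ⟨k, a, -, ha, rfl⟩ :=
      (copiesChart F hχ A Set.univ).mem_dom_of_entry_left_ne h
    obtain ⟨k', a', -, ha', rfl⟩ :=
      (copiesChart F hχ A Set.univ).mem_dom_of_entry_right_ne h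
    by_cases haW : a ∈ cutNbhd α 11
    -- Over `cutNbhd α 11` the swindle is the identity, so it has no entry off the diagonal.
    · suffices F.pos k a = F.pos k' a' by rw [this]
      by_contra hne
      refine h (entry_eq_zero_of_embed_comp F hχ (isEmbeddable_of_isNarrow F hχ k)
        (hWχ haW) ?_)
      have h1 := cutoff_comp_cutoff hχ hW (φ := 𝟙 A) fun a ha a' h' => by
        rw [← eq_of_entry_one_ne h']
        exact hWχ ha
      rw [Category.comp_id] at h1
      have h2 := cutoff_comp_cutoff hχ hW (φ := α.hom) fun a ha a' h' =>
        Or.inr ⟨a, ha, Or.inl (Or.inr h')⟩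
      have h3 := cutoff_comp_cutoff hχ hW (φ := α.inv) fun a ha a' h' =>
        Or.inr ⟨a, ha, Or.inr (Or.inr h')⟩
      have h4 := emb_swindle F hχ hα h1 h2 h3 k
      have h5 := congrArg (fun φ => entry φ a (F.pos k' a')) h4
      rw [Category.assoc] at h5
      simp only [entry_cutoff_comp, entry_cutoff_of_mem hW haW, Category.id_comp] at h5
      rw [h5]
      exact entry_embed_of_not F hχ _ fun h' => hne h'.2
    · have h1 := (isReach_swindle F hχ hα _ _ h 0 (by rwa [orig_pos F hχ ha])).2
      rw [orig_pos F hχ ha, orig_pos F hχ ha'] at h1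
      rw [F.p_pos, F.p_pos, F.newX_mem_Ioo_iff, F.newX_mem_Ioo_iff, h1]
  have supp : ∀ b ∈ (copies F hχ A Set.univ).supp,
      p b.1 ∉ frontier (Set.Ioo (1 / 2 : ℝ) (3 / 2)) := by
    intro b hb
    have hb' : b ∈ levelSet F (cutNbhd α 12) Set.univ := by
      by_contra h
      have h1 : Limits.IsZero ((copies F hχ A Set.univ).mod b) := isZero_pull_mod h
      have h2 := ModuleCat.subsingleton_of_isZero h1
      exact not_nontrivial_iff_subsingleton.2 h2 hb
    obtain ⟨k, a, -, ha, rfl⟩ := hb'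
    rw [frontier_Ioo (by norm_num), F.p_pos]
    rintro (h | h)
    · exact F.newX_ne k a 0 (by rw [h]; norm_num)
    · exact F.newX_ne k a 1 (by rw [Set.mem_singleton_iff.1 h]; norm_num)
  refine ⟨_, swindle F hχ hα, (cls_swindle F hχ hα).symm, supp, supp, fun a b ha hb => ⟨?_, ?_⟩⟩
  · by_contra h
    exact hb ((key a b h).1 ha)
  · by_contra h
    exact hb ((key b a h).2 ha)

/-! ### The frames of the two examples -/

/-- The frame of the real line with the translation action of the infinite cyclic group. -/
noncomputable def frameInfCyclic : Frame InfCyclic (id : ℝ → ℝ) where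
  o _ := 1
  n g := Multiplicative.toAdd g
  o_eq _ := Or.inl rfl
  smul_eq g x := by
    change ((Multiplicative.toAdd g : ℤ) : ℝ) + x = _
    ring
  p_smul _ _ := rfl
  put _ x := x
  p_put _ _ := rfl
  put_p _ := rfl
  put_put _ _ _ := rfl
  smul_put _ _ _ := rfl
  -- No element reverses the orientation, so a constant side is equivariant.
  eps _ := -1
  eps_eq _ := Or.inr rfl
  eps_smul _ _ := by norm_num
  translation m := ⟨Multiplicative.ofAdd m, fun x => by
    change ((m : ℤ) : ℝ) + x = _
    ring⟩
  continuous_p := continuous_id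
  proper _ _ := isCompact_Icc

/-- The frame of two copies of the real line with the action of the infinite dihedral group. -/
noncomputable def frameDInf : Frame DInf (Prod.snd : ZMod 2 × ℝ → ℝ) where
  o
    | .r _ => 1
    | .sr _ => -1
  n
    | .r i => i.cast
    | .sr i => -i.cast
  o_eq g := by rcases g with i | i <;> simp
  smul_eq g x := by
    rcases g with i | i
    · change (i.cast : ℝ) + x = 1 * x + ((i.cast : ℤ) : ℝ)
      rw [ZMod.intCast_cast]
      ring
    · change -((i.cast : ℝ) + x) = -1 * x + ((-i.cast : ℤ) : ℝ)
      rw [Int.cast_neg, ZMod.intCast_cast]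
      ring
  p_smul _ _ := rfl
  put y x := (y.1, x)
  p_put _ _ := rfl
  put_p _ := rfl
  put_put _ _ _ := rfl
  smul_put _ _ _ := rfl
  -- Elements reversing the orientation exchange the two sheets, so choosing opposite sides on the
  -- sheets is equivariant.
  eps y := if y.1 = 0 then -1 else 1
  eps_eq y := by
    split_ifs
    · exact Or.inr rfl
    · exact Or.inl rfl
  eps_smul g y := by
    rcases g with i | i
    · change (if y.1 = 0 then (-1 : ℝ) else 1) = 1 * _
      rw [one_mul]
    · change (if y.1 + 1 = 0 then (-1 : ℝ) else 1) = -1 * if y.1 = 0 then (-1 : ℝ) else 1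
      have h : ∀ e : ZMod 2, e + 1 = 0 ↔ ¬ e = 0 := by decide
      by_cases h0 : y.1 = 0
      · rw [if_pos h0, if_neg (fun h1 => (h _).1 h1 h0)]
        norm_num
      · rw [if_neg h0, if_pos ((h _).2 h0)]
        norm_num
  translation m := ⟨.r (m : ZMod 0), fun x => by
    change (m : ℝ) + x = _
    ring⟩
  continuous_p := continuous_snd
  proper r s := by
    have h : (Prod.snd : ZMod 2 × ℝ → ℝ) ⁻¹' Set.Icc r s = Set.univ ×ˢ Set.Icc r s := by
      ext
      simp
    rw [h]
    exact (Set.toFinite _).isCompact.prod isCompact_Icc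

end ControlledAlgebra

theorem theorem4p4 (R : Type u) [Ring R] :
    (∀ (A : ControlledAlgebra.OTilde R) (α : Aut A),
      ControlledAlgebra.Obstr.IsEpsAut (1 / 30) α →
      ∃ (B : ControlledAlgebra.OTilde R) (β : Aut B),
        ControlledAlgebra.K1.cls α = ControlledAlgebra.K1.cls β ∧
        ControlledAlgebra.Obstr.RestrictsTo (Set.Ioo (1 / 2) (3 / 2)) β.hom) ∧
    (∀ (A : ControlledAlgebra.ODInf R) (α : Aut A),
      ControlledAlgebra.Obstr.IsEpsAut (1 / 30) α →
      ∃ (B : ControlledAlgebra.ODInf R) (β : Aut B),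
        ControlledAlgebra.K1.cls α = ControlledAlgebra.K1.cls β ∧
        ControlledAlgebra.Obstr.RestrictsTo (Set.Ioo (1 / 2) (3 / 2)) β.hom) :=
  ⟨ControlledAlgebra.exists_restrictsTo ControlledAlgebra.frameInfCyclic,
    ControlledAlgebra.exists_restrictsTo ControlledAlgebra.frameDInf⟩
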